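/- **Model.** For each $n\ge 1$ let $\mathbf w^{(n)}=(w^{(n)}_1,\dots,w^{(n)}_n)$ be a random (or deterministic) vector of nonnegative weights, and put $p_i=w^{(n)}_i/\sum_j w^{(n)}_j$ (with $0/0:=0$). Conditionally on $\mathbf w^{(n)}$, object $i\in\{1,\dots,n\}$ is requested at the jump times of a Poisson process of rate $p_i$, these processes being independent. The objects form a list, started in an arbitrary order; each requested object is instantaneously moved to the front, the relative order of the others being unchanged (move-to-front rule). Let $R_t$ be the set of objects requested at least once in $[0,t)$. The search cost $S^{(n)}(t)$ is the position at time $t$ (after the requests in $[0,t)$), counted from $1$, of the first object requested in $[t,\infty)$, and $S^{(n)}(t):=0$ if there is no such object. Its equilibrium part $S^{(n)}_{\mathbf e}(t)$ equals $S^{(n)}(t)$ if that object belongs to $R_t$, and $0$ otherwise. **Condition LLN-$P$.** $P$ is a probability measure on $[0,\infty)$ with finite mean $\mu\neq 0$, and there are positive random variables $Z_n$ such that, as $n\to\infty$, the empirical measures $\frac1n\sum_{i=1}^n\delta_{Z_nw^{(n)}_i}$ converge in law to the constant $P$ (as random elements of the space of probability measures on $[0,\infty)$ with the weak topology) and the empirical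 means $\frac1n\sum_{i=1}^n Z_nw^{(n)}_i$ converge in law to $\mu$. **Theorem.** For $t,\lambda\ge 0$ let $$A_n(t,\lambda):=\mathbb E\bigl(e^{-\lambda S^{(n)}_{\mathbf e}(t)}\mathbf 1_{\{S^{(n)}_{\mathbf e}(t)>0\}}\bigr),\qquad A_n'(t,\lambda):=\mathbb E\bigl(e^{-\lambda S^{(n)}(t)}\mathbf 1_{\{S^{(n)}(t)\le |R_t|\}}\bigr).$$ Assume LLN-$P$ and let $\phi(u)=\int e^{-xu}P(dx)$ be the Laplace transform of $P$. If $\sum_i w_i^{(n)}>0$ almost surely, then $A_n=A_n'$. Moreover, for all $t,\lambda\ge0$, $$\lim_{n\to\infty}A_n(n\mu t,\lambda/n)=\lim_{n\to\infty}A_n'(n\mu t,\lambda/n)=\frac1\mu\int_0^t\Bigl(\int_{[0,\infty)}x^2e^{-xu}\,P(dx)\Bigr)\exp\{-\lambda(1-\phi(u))\}\,du ,$$ where the inner integral is finite for every $u>0$ and the outer integrand is integrable on $[0,t]$. -/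

import Mathlib

open MeasureTheory ProbabilityTheory Filter Topology
open scoped NNReal ENNReal BoundedContinuousFunction

namespace MoveToFront

/-- The popularities `p i = w i / ∑ j, w j` of the objects with weights `w` (with `0 / 0 = 0`). -/
noncomputable def popularity {n : ℕ} (w : Fin n → ℝ≥0) (i : Fin n) : ℝ≥0 :=
  w i / ∑ j, w j

/-! ### The request processes -/

/-- `N i t` is the number of requests of object `i` in the time interval `[0, t]`. Conditionally on
the random weight vector `w`, the processes `N i` are independent Poisson processes, `N i` having
rate `p i`, the popularity of object `i`; so requests arrive at total rate one (unless all the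
weights vanish). The paths are almost surely counting functions, and conditionally on `w` the
increments over consecutive time intervals are independent Poisson variables. -/
structure IsRequestProcess {Ω : Type*} [MeasurableSpace Ω] (prob : Measure Ω) {n : ℕ}
    (w : Ω → Fin n → ℝ≥0) (N : Fin n → ℝ≥0 → Ω → ℕ) : Prop where
  measurable : ∀ i t, Measurable (N i t)
  paths : ∀ᵐ ω ∂prob, ∀ i, N i 0 ω = 0 ∧ Monotone (fun t ↦ N i t ω) ∧
    ∀ t, ContinuousWithinAt (fun s ↦ N i s ω) (Set.Ici t) t
  law : ∀ (m : ℕ) (τ : Fin (m + 1) → ℝ≥0), Monotone τ →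
    ∀ (k : Fin n → Fin m → ℕ) (B : Set (Fin n → ℝ≥0)), MeasurableSet B →
      prob {ω | w ω ∈ B ∧ ∀ i l, N i (τ l.succ) ω = N i (τ l.castSucc) ω + k i l} =
        ∫⁻ ω in w ⁻¹' B,
          ∏ i, ∏ l, poissonMeasure (popularity (w ω) i * (τ l.succ - τ l.castSucc)) {k i l} ∂prob

/-! ### The list and the search cost, along one realization `c` of the counting processes -/

section Paths

variable {n : ℕ}

/-- The total number of requests in `[0, t]`. -/
def totalCount (c : Fin n → ℝ≥0 → ℕ) (t : ℝ≥0) : ℕ := ∑ i, c i t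

/-- The `k`-th request (`k = 1, 2, …`, in chronological order) is a request of object `i`: at some
time `s` the total count reaches `k` and the count of object `i` jumps. -/
def IsKthRequest (c : Fin n → ℝ≥0 → ℕ) (k : ℕ) (i : Fin n) : Prop :=
  ∃ s, Function.leftLim (totalCount c) s < k ∧ k ≤ totalCount c s ∧
    Function.leftLim (c i) s < c i s

open Classical in
/-- The object of the `k`-th request, for `k = 1, 2, …`; `none` if there is no such request.
(Almost surely no two requests are simultaneous, so that there is at most one candidate.) -/
noncomputable def request (c : Fin n → ℝ≥0 → ℕ) (k : ℕ) : Option (Fin n) :=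
  if h : ∃ i, IsKthRequest c k i then some h.choose else none

/-- The effect of a request of object `i` on the positions `q j ∈ {1, …, n}` of the objects: object
`i` moves to position one, and the relative order of the other objects is unchanged. -/
def moveToFront (q : Fin n → ℕ) (i j : Fin n) : ℕ :=
  if j = i then 1 else if q j < q i then q j + 1 else q j

/-- The position of each object after the first `k` requests, starting from the list in which
object `j` has position `π j` (counted from one). -/
noncomputable def positionAfter (π : Equiv.Perm (Fin n)) (c : Fin n → ℝ≥0 → ℕ) :
    ℕ → Fin n → ℕ
  | 0 => fun j ↦ (π j : ℕ) + 1
  | k + 1 =>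
    match request c (k + 1) with
    | none => positionAfter π c k
    | some i => moveToFront (positionAfter π c k) i

/-- The position at time `t` of each object: requests in `[0, t)` have been taken into account. -/
noncomputable def position (π : Equiv.Perm (Fin n)) (c : Fin n → ℝ≥0 → ℕ) (t : ℝ≥0) :
    Fin n → ℕ :=
  positionAfter π c (Function.leftLim (totalCount c) t)

/-- The set of objects that have been requested at least once in `[0, t)`. -/
noncomputable def requestedBefore (c : Fin n → ℝ≥0 → ℕ) (t : ℝ≥0) : Finset (Fin n) :=
  {i | 0 < Function.leftLim (c i) t}

/-- The first object requested in `[t, ∞)`. -/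
noncomputable def nextRequest (c : Fin n → ℝ≥0 → ℕ) (t : ℝ≥0) : Option (Fin n) :=
  request c (Function.leftLim (totalCount c) t + 1)

/-- The search cost at time `t`: the position at time `t` of the first object requested
in `[t, ∞)` (zero if there is none). -/
noncomputable def searchCost (π : Equiv.Perm (Fin n)) (c : Fin n → ℝ≥0 → ℕ) (t : ℝ≥0) : ℕ :=
  ∑ i, if nextRequest c t = some i then position π c t i else 0

open Classical in
/-- The equilibrium part of the search cost: the search cost if the requested object has already
been requested in `[0, t)`, and zero otherwise. -/
noncomputable def equilibriumCost (π : Equiv.Perm (Fin n)) (c : Fin n → ℝ≥0 → ℕ) (t : ℝ≥0) : ℕ :=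
  if ∃ i ∈ requestedBefore c t, nextRequest c t = some i then searchCost π c t else 0

end Paths

/-! ### The transforms -/

/-- `E (exp (-lam * S) ; S > 0)`, where `S` is the equilibrium part of the search cost at
time `t`. -/
noncomputable def equilibriumTransform {Ω : Type*} [MeasurableSpace Ω] (prob : Measure Ω) {n : ℕ}
    (π : Ω → Equiv.Perm (Fin n)) (N : Fin n → ℝ≥0 → Ω → ℕ) (t : ℝ≥0) (lam : ℝ) : ℝ :=
  ∫ ω, Set.indicator {ω | 0 < equilibriumCost (π ω) (fun i s ↦ N i s ω) t}
    (fun ω ↦ Real.exp (-lam * equilibriumCost (π ω) (fun i s ↦ N i s ω) t)) ω ∂prob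

/-- `E (exp (-lam * S) ; S ≤ |R|)`, where `S` is the search cost at time `t` and `R` the set of
objects requested in `[0, t)`. -/
noncomputable def earlyTransform {Ω : Type*} [MeasurableSpace Ω] (prob : Measure Ω) {n : ℕ}
    (π : Ω → Equiv.Perm (Fin n)) (N : Fin n → ℝ≥0 → Ω → ℕ) (t : ℝ≥0) (lam : ℝ) : ℝ :=
  ∫ ω, Set.indicator {ω | searchCost (π ω) (fun i s ↦ N i s ω) t ≤
      (requestedBefore (fun i s ↦ N i s ω) t).card}
    (fun ω ↦ Real.exp (-lam * searchCost (π ω) (fun i s ↦ N i s ω) t)) ω ∂prob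

/-! ### The law of large numbers condition -/

/-- The empirical measure `(1 / n) ∑ i, δ_{v i}` of a vector of length `n` (the Dirac mass at zero
by convention if `n = 0`). -/
noncomputable def empiricalMeasure {n : ℕ} (v : Fin n → ℝ≥0) : ProbabilityMeasure ℝ≥0 :=
  if hn : n = 0 then ⟨Measure.dirac 0, inferInstance⟩
  else ⟨(n : ℝ≥0∞)⁻¹ • ∑ i, Measure.dirac (v i), ⟨by
    simp [ENNReal.inv_mul_cancel (Nat.cast_ne_zero.2 hn) (ENNReal.natCast_ne_top n)]⟩⟩

/-- The mean of a probability measure on `[0, ∞)` (used for measures with a finite mean). -/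
noncomputable def mean (P : ProbabilityMeasure ℝ≥0) : ℝ≥0 :=
  ⟨∫ x, (x : ℝ) ∂(P : Measure ℝ≥0), integral_nonneg fun x ↦ x.2⟩

/-- The Laplace transform of a probability measure on `[0, ∞)`. -/
noncomputable def laplaceTransform (P : ProbabilityMeasure ℝ≥0) (u : ℝ) : ℝ :=
  ∫ x, Real.exp (-(x : ℝ) * u) ∂(P : Measure ℝ≥0)

/-- The law of large numbers condition with limiting law `P`: the probability measure `P` has a
finite nonzero mean, and there are positive random variables `Z n` such that the empirical measures
of the rescaled weights `Z n * w n i` converge in law to the constant `P`, as random elements of the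
space of probability measures on `[0, ∞)` with the topology of weak convergence, and the empirical
means of the rescaled weights converge in law to the mean of `P`. -/
def LLN {Ω : ℕ → Type*} [∀ n, MeasurableSpace (Ω n)] (prob : ∀ n, Measure (Ω n))
    [∀ n, IsProbabilityMeasure (prob n)] (w : ∀ n, Ω n → Fin n → ℝ≥0)
    (P : ProbabilityMeasure ℝ≥0) : Prop :=
  Integrable (fun x : ℝ≥0 ↦ (x : ℝ)) (P : Measure ℝ≥0) ∧ mean P ≠ 0 ∧
  ∃ Z : ∀ n, Ω n → ℝ≥0, (∀ n, Measurable (Z n)) ∧ (∀ n, ∀ᵐ ω ∂prob n, 0 < Z n ω) ∧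
    (∀ Ψ : ProbabilityMeasure ℝ≥0 →ᵇ ℝ,
      Tendsto (fun n ↦ ∫ ω, Ψ (empiricalMeasure fun i ↦ Z n ω * w n ω i) ∂prob n)
        atTop (𝓝 (Ψ P))) ∧
    TendstoInDistribution (fun n ω ↦ (∑ i, Z n ω * w n ω i) / (n : ℝ≥0)) atTop
      (fun _ : Unit ↦ mean P) prob (Measure.dirac ())

end MoveToFront

namespace MoveToFront

open Function (leftLim)

/-! ### Monotone integer-valued functions on the half-line -/

section CountingFunctions

variable {f : ℝ≥0 → ℕ}

/-! Fix the weights, with popularities `p i` summing to one, and set `ζ = exp (-lam)`. By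
independence of the increments, the next object requested after `t` is `i` with probability `p i`,
independently of the past. Looking back from `t`, the last request of `i` lies a time `u < t` ago
with density `p i * exp (-(p i * u))`. The position of `i` is then one plus the number of other
objects requested during that time, a sum of independent indicators. Hence the conditional transform
is the integral over `[0, t)` of `∑ i, p i ^ 2 * exp (-(p i * u)) * ζ * ∏ j ≠ i, (exp (-(p j * u)) +
ζ * (1 - exp (-(p j * u))))`; this is `costMean`.

The law of the processes is given only through increments over finite grids, so this formula is
reached by discretization. For mesh `h` the grid sums `pastWeight` and `futureIndicator` depend on
increments alone, and almost surely the resulting approximation of the cost is exact once `h` is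
small. Their expectations follow from products of Poisson laws (`lintegral_prod`), and
`lintegral_equilibriumCost` lets `h` tend to zero on both sides. This needs almost surely no common
jumps and no jump at `t`.

For the asymptotics, measuring time in units of the inverse total weight replaces `p` by the weights
`v`. When `ζ = exp (-lam / n)`, the product tends to `exp (-lam * (1 - φ s))` and `(1 / n) ∑ v i ^ 2
* exp (-v i * s)` tends to the second derivative of `φ` at `s`, for each `s > 0`. No fixed
dominating function near `s = 0` is available, but the second derivative of the Laplace transform of
a law with finite mean integrates over `(0, ∞)` to that mean, and the empirical means converge by
assumption. Dominated convergence with varying dominating functions therefore applies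
(`tendsto_costMean`). Convergence in law to a constant is convergence in probability, popularities
do not see the factor `Z n`, and the conditional transforms lie in `[0, 1]`, so their expectations
converge too.

The requested objects always occupy the first `|R|` positions, so the two transforms differ only
where no next request exists. There the cost is zero and the second transform collects one; up to
null sets this is the event that all weights vanish (`earlyTransform_eq`). Its probability tends to
zero because the limiting mean is nonzero. -/

theorem leftLim_zero (f : ℝ≥0 → ℕ) : leftLim f 0 = f 0 :=
  leftLim_eq_of_isBot fun _ ↦ zero_le

theorem eventually_eq_leftLim (hf : Monotone f) (s : ℝ≥0) :
    ∀ᶠ u in 𝓝[<] s, f u = leftLim f s := by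
  have h := hf.tendsto_leftLim s
  rwa [nhds_discrete, tendsto_pure] at h

theorem exists_lt_eq_leftLim (hf : Monotone f) {s r : ℝ≥0} (hr : r < s) :
    ∃ u, r < u ∧ u < s ∧ f u = leftLim f s := by
  have : (𝓝[<] s).NeBot := nhdsLT_neBot_of_exists_lt ⟨r, hr⟩
  obtain ⟨u, h1, h2, h3⟩ := ((eventually_eq_leftLim hf s).and
    ((eventually_nhdsWithin_of_eventually_nhds (lt_mem_nhds hr)).and
      (eventually_mem_nhdsWithin (a := s) (s := Set.Iio s)))).exists
  exact ⟨u, h2, h3, h1⟩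

theorem leftLim_le_self (hf : Monotone f) (s : ℝ≥0) : leftLim f s ≤ f s := hf.leftLim_le le_rfl

theorem exists_eq_of_right_continuous {s : ℝ≥0} (hf : ContinuousWithinAt f (Set.Ici s) s) :
    ∃ ε : ℝ≥0, 0 < ε ∧ ∀ u, s ≤ u → u < s + ε → f u = f s := by
  have h : ∀ᶠ u in 𝓝[≥] s, f u = f s := by
    have h := hf.tendsto
    rwa [nhds_discrete, tendsto_pure] at h
  obtain ⟨v, hv, hsub⟩ := (mem_nhdsGE_iff_exists_Ico_subset' (lt_add_one s)).1 h
  refine ⟨v - s, tsub_pos_of_lt hv, fun u hu hu' ↦ hsub ⟨hu, ?_⟩⟩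
  rwa [add_tsub_cancel_of_le (le_of_lt hv)] at hu'

/-- A right-continuous counting function reaches each level it exceeds at a definite time. -/
theorem exists_hitting_time (hf : Monotone f)
    (hr : ∀ s, ContinuousWithinAt f (Set.Ici s) s) {t : ℝ≥0} {k : ℕ} (h0 : f 0 < k)
    (hk : k ≤ f t) : ∃ s, 0 < s ∧ s ≤ t ∧ leftLim f s < k ∧ k ≤ f s := by
  set A : Set ℝ≥0 := {s | k ≤ f s}
  have hne : A.Nonempty := ⟨t, hk⟩
  have hle : ∀ s ∈ A, sInf A ≤ s := fun s hs ↦ csInf_le (OrderBot.bddBelow A) hs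
  have hmem : k ≤ f (sInf A) := by
    obtain ⟨ε, hε, h⟩ := exists_eq_of_right_continuous (hr (sInf A))
    obtain ⟨u, hu, hu'⟩ := exists_lt_of_csInf_lt hne (lt_add_of_pos_right (sInf A) hε)
    rw [← h u (hle u hu) hu']
    exact hu
  have hpos : 0 < sInf A := by
    rw [pos_iff_ne_zero]
    intro h
    rw [h] at hmem
    omega
  refine ⟨sInf A, hpos, hle t hk, ?_, hmem⟩
  obtain ⟨u, -, hu, h⟩ := exists_lt_eq_leftLim hf hpos
  rw [← h]
  by_contra! hcon
  exact absurd (hle u hcon) (not_le.2 hu)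

/-- Used in both directions, this makes the time at which a given level is crossed unique. -/
theorem le_of_leftLim_lt_le (hf : Monotone f) {s s' : ℝ≥0} {k : ℕ}
    (h : k ≤ f s) (h' : leftLim f s' < k) : s' ≤ s := by
  by_contra! hlt
  have := hf.le_leftLim hlt
  omega

end CountingFunctions

/-! ### Requests along paths without simultaneous jumps. -/

section Paths

variable {n : ℕ} {c : Fin n → ℝ≥0 → ℕ}

/-- The paths `c i` are right-continuous counting functions without common jumps. -/
structure IsSimplePath (c : Fin n → ℝ≥0 → ℕ) : Prop where
  zero : ∀ i, c i 0 = 0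
  mono : ∀ i, Monotone (c i)
  right : ∀ i s, ContinuousWithinAt (c i) (Set.Ici s) s
  simple : ∀ i j s, leftLim (c i) s < c i s → leftLim (c j) s < c j s → i = j

namespace IsSimplePath

variable (hc : IsSimplePath c)
include hc

theorem monotone_totalCount : Monotone (totalCount c) := fun _ _ h ↦
  Finset.sum_le_sum fun i _ ↦ hc.mono i h

theorem right_totalCount (s : ℝ≥0) : ContinuousWithinAt (totalCount c) (Set.Ici s) s :=
  tendsto_finsetSum _ fun i _ ↦ hc.right i s

theorem totalCount_zero : totalCount c 0 = 0 := by simp [totalCount, hc.zero]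

theorem leftLim_totalCount (s : ℝ≥0) : leftLim (totalCount c) s = ∑ i, leftLim (c i) s := by
  rcases eq_or_ne s 0 with rfl | hs
  · simp only [leftLim_zero, totalCount]
  · have : (𝓝[<] s).NeBot := nhdsLT_neBot_of_exists_lt ⟨0, pos_iff_ne_zero.2 hs⟩
    -- Integer-valued left limits are attained just before `s`, and finitely many of them at one
    -- common point `u`.
    obtain ⟨u, h1, h2⟩ := ((eventually_eq_leftLim hc.monotone_totalCount s).and
      (eventually_all.2 fun i ↦ eventually_eq_leftLim (hc.mono i) s)).exists
    rw [← h1, totalCount]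
    exact Finset.sum_congr rfl fun i _ ↦ h2 i

theorem leftLim_totalCount_lt {i : Fin n} {s : ℝ≥0} (h : leftLim (c i) s < c i s) :
    leftLim (totalCount c) s < totalCount c s := by
  rw [hc.leftLim_totalCount]
  exact Finset.sum_lt_sum (fun j _ ↦ leftLim_le_self (hc.mono j) s) ⟨i, Finset.mem_univ i, h⟩

theorem exists_jump {s : ℝ≥0} (h : leftLim (totalCount c) s < totalCount c s) :
    ∃ i, leftLim (c i) s < c i s := by
  rw [hc.leftLim_totalCount] at h
  obtain ⟨i, -, hi⟩ := Finset.exists_lt_of_sum_lt h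
  exact ⟨i, hi⟩

theorem isKthRequest_unique {k : ℕ} {i j : Fin n} (hi : IsKthRequest c k i)
    (hj : IsKthRequest c k j) : i = j := by
  obtain ⟨s, h1, h2, h3⟩ := hi
  obtain ⟨s', h1', h2', h3'⟩ := hj
  have e : s = s' := le_antisymm (le_of_leftLim_lt_le hc.monotone_totalCount h2' h1)
    (le_of_leftLim_lt_le hc.monotone_totalCount h2 h1')
  subst e
  exact hc.simple i j s h3 h3'

theorem request_eq_some_iff {k : ℕ} {i : Fin n} :
    request c k = some i ↔ IsKthRequest c k i := by
  unfold request
  split_ifs with h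
  · rw [Option.some_inj]
    refine ⟨fun e ↦ e ▸ h.choose_spec, fun e ↦ hc.isKthRequest_unique h.choose_spec e⟩
  · simp only [false_iff]
    exact fun h' ↦ h ⟨i, h'⟩

end IsSimplePath

/-! ### The move-to-front rule along a sequence of requests -/

/-- `q` lists the objects in the positions `1, …, n`. -/
def IsListing (q : Fin n → ℕ) : Prop := Function.Injective q ∧ ∀ i, 1 ≤ q i ∧ q i ≤ n

/-- An injection of `n` objects into `{1, …, n}` fills every position, so a position is a rank.
Computing a search cost thereby becomes counting the objects in front. -/
theorem IsListing.eq_card {q : Fin n → ℕ} (hq : IsListing q) (i : Fin n) :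
    q i = 1 + (Finset.univ.filter fun j ↦ q j < q i).card := by
  have himg : Finset.univ.image q = Finset.Icc 1 n := by
    apply Finset.eq_of_subset_of_card_le
    · intro x hx
      obtain ⟨j, -, rfl⟩ := Finset.mem_image.1 hx
      exact Finset.mem_Icc.2 (hq.2 j)
    · rw [Finset.card_image_of_injective _ hq.1]
      simp
  have h2 : (Finset.univ.filter fun j ↦ q j < q i).image q = Finset.Ico 1 (q i) := by
    ext x
    simp only [Finset.mem_image, Finset.mem_filter, Finset.mem_univ, true_and, Finset.mem_Ico]
    constructor
    · rintro ⟨j, hj, rfl⟩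
      exact ⟨(hq.2 j).1, hj⟩
    · rintro ⟨h1, h2⟩
      have : x ∈ Finset.univ.image q := by
        rw [himg, Finset.mem_Icc]
        exact ⟨h1, h2.le.trans (hq.2 i).2⟩
      obtain ⟨j, -, rfl⟩ := Finset.mem_image.1 this
      exact ⟨j, h2, rfl⟩
  have h3 := congrArg Finset.card h2
  rw [Finset.card_image_of_injective _ hq.1, Nat.card_Ico] at h3
  have := (hq.2 i).1
  omega

theorem moveToFront_self (q : Fin n → ℕ) (i : Fin n) : moveToFront q i i = 1 := by
  simp [moveToFront]

theorem IsListing.moveToFront_lt_iff {q : Fin n → ℕ} (hq : IsListing q) {i j k : Fin n}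
    (hj : j ≠ i) (hk : k ≠ i) : moveToFront q i j < moveToFront q i k ↔ q j < q k := by
  have h1 : q j ≠ q i := fun h ↦ hj (hq.1 h)
  have h2 : q k ≠ q i := fun h ↦ hk (hq.1 h)
  simp only [moveToFront, if_neg hj, if_neg hk]
  split_ifs <;> omega

theorem IsListing.moveToFront {q : Fin n → ℕ} (hq : IsListing q) (i : Fin n) :
    IsListing (moveToFront q i) := by
  have hone : ∀ j, j ≠ i → 1 < MoveToFront.moveToFront q i j := by
    intro j hj
    have h1 := (hq.2 j).1
    have h2 := (hq.2 i).1
    have h3 : q j ≠ q i := fun h ↦ hj (hq.1 h)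
    simp only [MoveToFront.moveToFront, if_neg hj]
    split_ifs <;> omega
  refine ⟨fun j k hjk ↦ ?_, fun j ↦ ?_⟩
  · by_cases hj : j = i
    · by_cases hk : k = i
      · rw [hj, hk]
      · have := hone k hk
        rw [← hjk, hj, moveToFront_self] at this
        omega
    · by_cases hk : k = i
      · have := hone j hj
        rw [hjk, hk, moveToFront_self] at this
        omega
      · apply hq.1
        have h1 := (hq.moveToFront_lt_iff hj hk).not
        have h2 := (hq.moveToFront_lt_iff hk hj).not
        rw [hjk] at h1 h2
        simp only [lt_irrefl, not_false_eq_true, not_lt, true_iff] at h1 h2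
        exact le_antisymm h2 h1
  · by_cases hj : j = i
    · rw [hj, moveToFront_self]
      exact ⟨le_rfl, (hq.2 i).1.trans (hq.2 i).2⟩
    · refine ⟨(hone j hj).le, ?_⟩
      have h1 := (hq.2 j).2
      have h2 := (hq.2 i).2
      simp only [MoveToFront.moveToFront, if_neg hj]
      split_ifs <;> omega

theorem IsListing.moveToFront_self_lt {q : Fin n → ℕ} (hq : IsListing q) {i j : Fin n}
    (hj : j ≠ i) : MoveToFront.moveToFront q i i < MoveToFront.moveToFront q i j := by
  have h := (hq.moveToFront i)
  refine lt_of_le_of_ne ?_ fun e ↦ hj (h.1 e).symm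
  rw [moveToFront_self]
  exact (h.2 j).1

theorem isListing_positionAfter (π : Equiv.Perm (Fin n)) (c : Fin n → ℝ≥0 → ℕ) (k : ℕ) :
    IsListing (positionAfter π c k) := by
  induction k with
  | zero =>
    refine ⟨fun i j h ↦ ?_, fun i ↦ ?_⟩
    · simp only [positionAfter, Nat.add_right_cancel_iff] at h
      exact π.injective (Fin.ext h)
    · simp only [positionAfter]
      have := (π i).2
      omega
  | succ k ih =>
    simp only [positionAfter]
    split
    · exact ih
    · exact ih.moveToFront _

/-- An object is in front of `i` after `k` requests if it was requested after the last request of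
`i`, or if it was requested and `i` was not. -/
theorem positionAfter_lt_of_requested (π : Equiv.Perm (Fin n)) {a k : ℕ} {i j : Fin n}
    (hi : ∀ b, a < b → b ≤ k → request c b ≠ some i) (hj : ∃ b, a < b ∧ b ≤ k ∧
      request c b = some j) : positionAfter π c k j < positionAfter π c k i := by
  induction k with
  | zero =>
    obtain ⟨b, h1, h2, -⟩ := hj
    omega
  | succ k ih =>
    obtain ⟨b, h1, h2, h3⟩ := hj
    have hik : request c (k + 1) ≠ some i := hi (k + 1) (by omega) le_rfl
    -- If request `k + 1` is for `j`, then `j` is now at the front. Otherwise it concerns neither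
    -- object, and their relative order is inherited from time `k`.
    by_cases hjk : request c (k + 1) = some j
    · have hij : i ≠ j := fun e ↦ hik (e ▸ hjk)
      simp only [positionAfter, hjk]
      exact (isListing_positionAfter π c k).moveToFront_self_lt hij
    · have hb : b ≤ k := by
        rcases Nat.lt_or_ge k b with h | h
        · exact absurd ((show b = k + 1 by omega) ▸ h3) hjk
        · exact h
      have := ih (fun b h h' ↦ hi b h (by omega)) ⟨b, h1, hb, h3⟩
      rcases hl : request c (k + 1) with _ | l
      · simpa only [positionAfter, hl] using this
      · rw [hl] at hik hjk
        simp only [positionAfter, hl]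
        exact ((isListing_positionAfter π c k).moveToFront_lt_iff (fun e ↦ hjk (by rw [e]))
          (fun e ↦ hik (by rw [e]))).2 this

/-- An object in front of `i` was requested after each request of `i`. -/
theorem requested_of_positionAfter_lt (π : Equiv.Perm (Fin n)) {a k : ℕ} {i j : Fin n}
    (ha0 : 0 < a) (hak : a ≤ k) (hi : request c a = some i)
    (hlt : positionAfter π c k j < positionAfter π c k i) :
    ∃ b, a < b ∧ b ≤ k ∧ request c b = some j := by
  induction k, hak using Nat.le_induction with
  | base =>
    obtain ⟨a, rfl⟩ : ∃ m, a = m + 1 := ⟨a - 1, by omega⟩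
    simp only [positionAfter, hi, moveToFront_self] at hlt
    have := (((isListing_positionAfter π c a).moveToFront i).2 j).1
    omega
  | succ k hk ih =>
    by_cases hjk : request c (k + 1) = some j
    · exact ⟨k + 1, by omega, le_rfl, hjk⟩
    · suffices positionAfter π c k j < positionAfter π c k i by
        obtain ⟨b, h1, h2, h3⟩ := ih this
        exact ⟨b, h1, by omega, h3⟩
      rcases hl : request c (k + 1) with _ | l
      · simpa only [positionAfter, hl] using hlt
      · rw [hl] at hjk
        simp only [positionAfter, hl] at hlt
        have hjl : j ≠ l := fun e ↦ hjk (by rw [e])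
        by_cases hil : i = l
        · subst hil
          exact absurd hlt ((isListing_positionAfter π c k).moveToFront_self_lt hjl).le.not_gt
        · exact ((isListing_positionAfter π c k).moveToFront_lt_iff hjl hil).1 hlt

end Paths

/-! ### Search costs and their discretizations along one path. -/

section Costs

variable {n : ℕ} {c : Fin n → ℝ≥0 → ℕ} {t : ℝ≥0}

/-- The discretization with mesh `h` of the indicator of the event that object `i` is the first one
requested after time `t`. -/
noncomputable def futureIndicator (c : Fin n → ℝ≥0 → ℕ) (t h : ℝ≥0) (i : Fin n) : ℝ≥0∞ :=
  ∑' l : ℕ, if (∀ j, c j (t + l * h) = c j t) ∧ c i (t + l * h) < c i (t + (l + 1) * h) then 1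
    else 0

/-- The discretization with mesh `h` of `z ^ k` where `k` is the number of objects requested between
the last request of object `i` before time `t` and time `t`. -/
noncomputable def pastWeight (c : Fin n → ℝ≥0 → ℕ) (t h : ℝ≥0) (z : ℝ≥0∞) (i : Fin n) : ℝ≥0∞ :=
  ∑' l : ℕ, if c i (t - (l + 1) * h) < c i (t - l * h) ∧ c i (t - l * h) = c i t then
    ∏ j, (if c j (t - l * h) = c j t then 1 else z) else 0

namespace IsSimplePath

variable (hc : IsSimplePath c) (ht : ∀ i, leftLim (c i) t = c i t)
include hc

theorem totalCount_eq_iff {s s' : ℝ≥0} (h : s ≤ s') :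
    totalCount c s = totalCount c s' ↔ ∀ i, c i s = c i s' := by
  unfold totalCount
  rw [Finset.sum_eq_sum_iff_of_le fun i _ ↦ hc.mono i h]
  simp

theorem exists_last_jump {i : Fin n} (hi : 0 < c i t) :
    ∃ s, 0 < s ∧ s ≤ t ∧ leftLim (c i) s < c i s ∧ c i s = c i t := by
  obtain ⟨s, h0, h1, h2, h3⟩ := exists_hitting_time (hc.mono i) (hc.right i)
    (hc.zero i ▸ hi) (le_refl (c i t))
  have h4 := hc.mono i h1
  exact ⟨s, h0, h1, by omega, by omega⟩

include ht

theorem leftLim_totalCount_eq : leftLim (totalCount c) t = totalCount c t := by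
  rw [hc.leftLim_totalCount, totalCount]
  exact Finset.sum_congr rfl fun i _ ↦ ht i

/-- Without a jump at `t`, the requests in `[t, ∞)` are those in `(t, ∞)`, and the first of them is
the jump up to which the total count keeps its value at `t`. -/
theorem nextRequest_eq_some_iff {i : Fin n} : nextRequest c t = some i ↔
    ∃ s, t < s ∧ leftLim (totalCount c) s = totalCount c t ∧ leftLim (c i) s < c i s := by
  rw [nextRequest, hc.leftLim_totalCount_eq ht, hc.request_eq_some_iff]
  constructor
  · rintro ⟨s, h1, h2, h3⟩
    have hs : t < s := by
      by_contra! h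
      have := hc.monotone_totalCount h
      omega
    have := hc.monotone_totalCount.le_leftLim hs
    exact ⟨s, hs, by omega, h3⟩
  · rintro ⟨s, h1, h2, h3⟩
    have := hc.leftLim_totalCount_lt h3
    exact ⟨s, by omega, by omega, h3⟩

omit ht in
theorem exists_nextRequest {s : ℝ≥0} (h : totalCount c t < totalCount c s) :
    ∃ i s', s' ≤ s ∧ t < s' ∧ leftLim (totalCount c) s' = totalCount c t ∧
      leftLim (c i) s' < c i s' := by
  obtain ⟨s', -, h1, h2, h3⟩ := exists_hitting_time hc.monotone_totalCount hc.right_totalCount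
    (k := totalCount c t + 1) (by rw [hc.totalCount_zero]; omega) h
  have hs : t < s' := by
    by_contra! h
    have := hc.monotone_totalCount h
    omega
  have := hc.monotone_totalCount.le_leftLim hs
  obtain ⟨i, hi⟩ := hc.exists_jump (h2.trans_le h3)
  exact ⟨i, s', h1, hs, by omega, hi⟩

omit hc in
theorem mem_requestedBefore {i : Fin n} : i ∈ requestedBefore c t ↔ 0 < c i t := by
  simp [requestedBefore, ht]

omit ht in
/-- Requests with numbers in `(totalCount c s, totalCount c t]` are those made in `(s, t]`. -/
theorem exists_request_eq_iff {s : ℝ≥0} (j : Fin n) :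
    (∃ b, totalCount c s < b ∧ b ≤ totalCount c t ∧ request c b = some j) ↔ c j s < c j t := by
  constructor
  · rintro ⟨b, h1, h2, h3⟩
    obtain ⟨s', h4, h5, h6⟩ := hc.request_eq_some_iff.1 h3
    have hs' : s' ≤ t := le_of_leftLim_lt_le hc.monotone_totalCount h2 h4
    have hss : s < s' := by
      by_contra! h
      have := hc.monotone_totalCount h
      omega
    have h7 := (hc.mono j).le_leftLim hss
    have h8 := hc.mono j hs'
    omega
  · intro h
    obtain ⟨s', -, h1, h2, h3⟩ := exists_hitting_time (hc.mono j) (hc.right j)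
      (k := c j s + 1) (by rw [hc.zero]; omega) h
    have hss : s < s' := by
      by_contra! h
      have := hc.mono j h
      omega
    have h4 : leftLim (c j) s' < c j s' := by omega
    have h5 := hc.leftLim_totalCount_lt h4
    have h6 := hc.monotone_totalCount.le_leftLim hss
    exact ⟨totalCount c s', by omega, hc.monotone_totalCount h1,
      hc.request_eq_some_iff.2 ⟨s', h5, le_rfl, h4⟩⟩

/-- With `s` the time of the last request of `i`, the objects in front of `i` are exactly those
requested in `(s, t]`: they overtook `i`, and nothing else can be in front of an object that was at
the front at time `s`. -/
theorem position_eq_of_requested (π : Equiv.Perm (Fin n)) {i : Fin n} {s : ℝ≥0} (hs : s ≤ t)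
    (hj : leftLim (c i) s < c i s) (hi : c i s = c i t) :
    position π c t i = 1 + (Finset.univ.filter fun j ↦ c j s < c j t).card := by
  have hlt := hc.leftLim_totalCount_lt hj
  have hr : request c (totalCount c s) = some i :=
    hc.request_eq_some_iff.2 ⟨s, hlt, le_rfl, hj⟩
  have hni : ∀ b, totalCount c s < b → b ≤ totalCount c t → request c b ≠ some i := by
    intro b h1 h2 h3
    have := (hc.exists_request_eq_iff i).1 ⟨b, h1, h2, h3⟩
    omega
  rw [position, hc.leftLim_totalCount_eq ht,
    (isListing_positionAfter π c (totalCount c t)).eq_card i]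
  congr 2
  ext j
  simp only [Finset.mem_filter, Finset.mem_univ, true_and]
  rw [← hc.exists_request_eq_iff j]
  exact ⟨requested_of_positionAfter_lt π (by omega) (hc.monotone_totalCount hs) hr,
    positionAfter_lt_of_requested π hni⟩

theorem position_le_card (π : Equiv.Perm (Fin n)) {i : Fin n} (hi : 0 < c i t) :
    position π c t i ≤ (requestedBefore c t).card := by
  obtain ⟨s, -, h1, h2, h3⟩ := hc.exists_last_jump hi
  rw [hc.position_eq_of_requested ht π h1 h2 h3, Nat.add_comm, Nat.add_one_le_iff]
  apply Finset.card_lt_card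
  rw [Finset.ssubset_iff_of_subset]
  · exact ⟨i, (mem_requestedBefore ht).2 hi, by simp [h3]⟩
  · intro j hj
    rw [mem_requestedBefore ht]
    simp only [Finset.mem_filter, Finset.mem_univ, true_and] at hj
    omega

/-- Every requested object is in front of one never requested. Together with `position_le_card`,
this shows that comparing a position with `|R|` decides membership in `R`. -/
theorem card_lt_position (π : Equiv.Perm (Fin n)) {i : Fin n} (hi : c i t = 0) :
    (requestedBefore c t).card < position π c t i := by
  rw [position, hc.leftLim_totalCount_eq ht,
    (isListing_positionAfter π c (totalCount c t)).eq_card i, Nat.add_comm, Nat.lt_add_one_iff]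
  apply Finset.card_le_card
  intro j hj
  rw [mem_requestedBefore ht] at hj
  simp only [Finset.mem_filter, Finset.mem_univ, true_and]
  have h0 := hc.totalCount_zero
  apply positionAfter_lt_of_requested (a := 0)
  · intro b h1 h2 h3
    have := (hc.exists_request_eq_iff (s := 0) (t := t) i).1 ⟨b, by omega, h2, h3⟩
    omega
  · have := (hc.exists_request_eq_iff (s := 0) (t := t) j).2 (by rw [hc.zero]; exact hj)
    rwa [h0] at this

omit hc ht in
theorem searchCost_eq {π : Equiv.Perm (Fin n)} {i : Fin n} (hi : nextRequest c t = some i) :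
    searchCost π c t = position π c t i := by
  simp [searchCost, hi]

omit hc ht in
theorem searchCost_eq_zero {π : Equiv.Perm (Fin n)} (hi : nextRequest c t = none) :
    searchCost π c t = 0 := by
  simp [searchCost, hi]

omit hc in
theorem equilibriumCost_eq {π : Equiv.Perm (Fin n)} {i : Fin n} (hi : nextRequest c t = some i) :
    equilibriumCost π c t = if 0 < c i t then position π c t i else 0 := by
  simp [equilibriumCost, hi, searchCost_eq hi, mem_requestedBefore ht]

omit hc ht in
theorem equilibriumCost_eq_zero {π : Equiv.Perm (Fin n)} (hi : nextRequest c t = none) :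
    equilibriumCost π c t = 0 := by
  simp [equilibriumCost, hi]

/-- As long as there is a next request, its search cost is at most the number of requested objects
if and only if the equilibrium part is positive; the costs then agree. -/
theorem searchCost_le_iff (π : Equiv.Perm (Fin n)) (h : nextRequest c t ≠ none) :
    (searchCost π c t ≤ (requestedBefore c t).card ↔ 0 < equilibriumCost π c t) ∧
      (0 < equilibriumCost π c t → equilibriumCost π c t = searchCost π c t) := by
  obtain ⟨i, hi⟩ := Option.ne_none_iff_exists'.1 h
  rw [searchCost_eq hi, equilibriumCost_eq ht hi]
  by_cases h0 : 0 < c i t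
  · simp only [if_pos h0, hc.position_le_card ht π h0, true_iff, implies_true, and_true]
    obtain ⟨s, -, h1, h2, h3⟩ := hc.exists_last_jump h0
    rw [hc.position_eq_of_requested ht π h1 h2 h3]
    omega
  · have := hc.card_lt_position ht π (i := i) (by omega)
    simp [h0, this]

theorem futureIndicator_of_eq {i : Fin n} (hi : nextRequest c t = some i) {h : ℝ≥0} (hh : 0 < h) :
    futureIndicator c t h i = 1 := by
  obtain ⟨s, h1, h2, h3⟩ := (hc.nextRequest_eq_some_iff ht).1 hi
  have hlt := hc.leftLim_totalCount_lt h3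
  -- The cell `(t + l * h, t + (l + 1) * h]` containing the first request time `s` is the only one
  -- that contributes.
  obtain ⟨l, hl, hl'⟩ : ∃ l : ℕ, t + l * h < s ∧ s ≤ t + (l + 1) * h := by
    have hex : ∃ m : ℕ, s ≤ t + m * h := by
      obtain ⟨m, hm⟩ := exists_nat_ge (s / h)
      refine ⟨m, ?_⟩
      rw [div_le_iff₀ hh] at hm
      exact hm.trans le_add_self
    classical
    have hm := Nat.find_spec hex
    have hpos : Nat.find hex ≠ 0 := by
      intro h0
      rw [h0] at hm
      simp only [Nat.cast_zero, zero_mul, add_zero] at hm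
      exact absurd h1 (not_lt.2 hm)
    obtain ⟨l, hl⟩ := Nat.exists_eq_succ_of_ne_zero hpos
    refine ⟨l, not_le.1 (Nat.find_min hex (by omega)), ?_⟩
    rw [hl] at hm
    exact_mod_cast hm
  have hmono := hc.monotone_totalCount
  have hgrid : ∀ a b : ℕ, a ≤ b → t + a * h ≤ t + b * h := fun a b hab ↦ by gcongr
  have hconst : ∀ u, t ≤ u → u < s → ∀ j, c j u = c j t := by
    intro u hu hu' j
    have h4 := hmono.le_leftLim hu'
    have h5 := hmono hu
    exact ((hc.totalCount_eq_iff hu).1 (by omega) j).symm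
  rw [futureIndicator, tsum_eq_single l]
  · rw [if_pos]
    refine ⟨hconst _ le_self_add hl, ?_⟩
    have h4 := (hc.mono i).le_leftLim hl
    have h5 := hc.mono i hl'
    omega
  · intro m hm
    rw [if_neg]
    rintro ⟨h4, h5⟩
    rcases lt_or_gt_of_ne hm with hm | hm
    · have h6 : t + ((m : ℝ≥0) + 1) * h ≤ t + l * h := by exact_mod_cast hgrid (m + 1) l hm
      have h7 := hc.mono i h6
      rw [hconst _ le_self_add hl i] at h7
      have h8 := hc.mono i (show t ≤ t + m * h from le_self_add)
      omega
    · have h6 : t + ((l : ℝ≥0) + 1) * h ≤ t + m * h := by exact_mod_cast hgrid (l + 1) m hm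
      have h7 := hmono (hl'.trans h6)
      have h8 := (hc.totalCount_eq_iff (show t ≤ t + m * h from le_self_add)).2
        fun j ↦ (h4 j).symm
      omega

/-- If another object is requested first, at time `s`, then `i` is not requested until some time `s
+ ε`. For `h < ε`, a cell that begins before `s` ends before `s + ε` and so contains no request of
`i`, and a cell that begins later fails the constancy condition. -/
theorem futureIndicator_of_ne {i : Fin n} (hi : nextRequest c t ≠ some i) :
    ∃ ε : ℝ≥0, 0 < ε ∧ ∀ h, 0 < h → h < ε → futureIndicator c t h i = 0 := by
  by_cases hex : ∃ s, totalCount c t < totalCount c s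
  · obtain ⟨s₀, hs₀⟩ := hex
    obtain ⟨j, s, -, h1, h2, h3⟩ := hc.exists_nextRequest hs₀
    have hmono := hc.monotone_totalCount
    have hij : i ≠ j := by
      rintro rfl
      exact hi ((hc.nextRequest_eq_some_iff ht).2 ⟨s, h1, h2, h3⟩)
    -- Since `j` jumps at `s`, simplicity forbids a jump of `i` there; before `s` no count has
    -- changed since `t`.
    have his : c i s = c i t := by
      have h4 : leftLim (c i) s = c i s :=
        le_antisymm (leftLim_le_self (hc.mono i) s) (not_lt.1 fun h ↦ hij (hc.simple i j s h h3))
      obtain ⟨u, hu, hu', he⟩ := exists_lt_eq_leftLim hmono h1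
      have h5 := (hc.totalCount_eq_iff hu.le).1 (by omega)
      obtain ⟨v, hv, hv', he'⟩ := exists_lt_eq_leftLim (hc.mono i) h1
      have h6 := (hc.totalCount_eq_iff hv.le).1 (by
        have h7 := hmono hv.le
        have h8 := hmono.le_leftLim hv'
        omega) i
      omega
    obtain ⟨ε, hε, hconst⟩ := exists_eq_of_right_continuous (hc.right i s)
    refine ⟨ε, hε, fun h hh hhε ↦ ?_⟩
    rw [futureIndicator, ENNReal.tsum_eq_zero]
    intro l
    rw [if_neg]
    rintro ⟨h4, h5⟩
    have hts : t + l * h < s := by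
      by_contra! hge
      have h6 := (hc.totalCount_eq_iff (show t ≤ t + l * h from le_self_add)).2
        fun j ↦ (h4 j).symm
      have h7 := hmono hge
      have h8 := hc.leftLim_totalCount_lt h3
      omega
    have h6 : c i (t + (l + 1) * h) = c i t := by
      rcases le_or_gt s (t + (l + 1) * h) with h7 | h7
      · rw [hconst _ h7, his]
        rw [add_mul, one_mul, ← add_assoc]
        exact add_lt_add hts hhε
      · apply le_antisymm
        · exact his ▸ hc.mono i h7.le
        · exact hc.mono i le_self_add
    have h7 := h4 i
    omega
  · push Not at hex
    refine ⟨1, one_pos, fun h _ _ ↦ ?_⟩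
    rw [futureIndicator, ENNReal.tsum_eq_zero]
    intro l
    rw [if_neg]
    rintro ⟨h4, h5⟩
    have h6 := (hc.totalCount_eq_iff (show t ≤ t + (l + 1) * h from le_self_add)).1
      (le_antisymm (hc.monotone_totalCount le_self_add) (hex _)) i
    have h7 := h4 i
    omega

omit hc ht in
theorem pastWeight_of_eq_zero {i : Fin n} (hi : c i t = 0) (h : ℝ≥0) (z : ℝ≥0∞) :
    pastWeight c t h z i = 0 := by
  rw [pastWeight, ENNReal.tsum_eq_zero]
  intro l
  rw [if_neg]
  omega

omit ht in
-- Only the cell containing the last request time `s` contributes. For small `h` its right end lies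
-- in `[s, s + ε)`, where by right-continuity all counts have their values at `s`, so the product
-- counts the objects requested in `(s, t]`.
theorem pastWeight_of_last_jump {i : Fin n} {s : ℝ≥0} (hs0 : 0 < s) (hs : s ≤ t)
    (hj : leftLim (c i) s < c i s) (hi : c i s = c i t) (z : ℝ≥0∞) :
    ∃ ε : ℝ≥0, 0 < ε ∧ ∀ h, 0 < h → h < ε →
      pastWeight c t h z i = z ^ (Finset.univ.filter fun j ↦ c j s < c j t).card := by
  have hev : ∀ᶠ ε : ℝ≥0 in 𝓝[>] 0, ∀ j, ∀ u, s ≤ u → u < s + ε → c j u = c j s := by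
    refine eventually_all.2 fun j ↦ ?_
    obtain ⟨ε, hε, h⟩ := exists_eq_of_right_continuous (hc.right j s)
    filter_upwards [eventually_nhdsWithin_of_eventually_nhds (gt_mem_nhds hε)] with δ hδ u hu hu'
    exact h u hu (hu'.trans (by gcongr))
  obtain ⟨ε, hconst, hε⟩ := (hev.and self_mem_nhdsWithin).exists
  refine ⟨ε, hε, fun h hh hhε ↦ ?_⟩
  set l := ⌊(t - s) / h⌋₊
  have h1 : (l : ℝ≥0) * h ≤ t - s := by
    rw [← le_div_iff₀ hh]
    exact Nat.floor_le zero_le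
  have h2 : t - s < ((l : ℝ≥0) + 1) * h := by
    rw [← div_lt_iff₀ hh]
    exact Nat.lt_floor_add_one _
  have h3 : s ≤ t - l * h := by
    rw [le_tsub_iff_right (h1.trans tsub_le_self), add_comm, ← le_tsub_iff_right hs]
    exact h1
  -- If the grid overshoots time zero, truncated subtraction gives `0`, and `0 < s` still puts `s`
  -- inside the cell.
  have h4 : t - (l + 1) * h < s := by
    rcases le_total t ((l + 1) * h) with h4 | h4
    · rwa [tsub_eq_zero_of_le h4]
    · rw [← NNReal.coe_lt_coe, NNReal.coe_sub h4]
      rw [← NNReal.coe_lt_coe, NNReal.coe_sub hs] at h2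
      linarith
  have h5 : t - l * h < s + ε := by
    rw [← NNReal.coe_lt_coe, NNReal.coe_sub (h1.trans tsub_le_self)]
    rw [← NNReal.coe_lt_coe, NNReal.coe_sub hs] at h2
    rw [← NNReal.coe_lt_coe] at hhε
    push_cast at h2 ⊢
    linarith
  have hval : ∀ j, c j (t - l * h) = c j s := fun j ↦ hconst j _ h3 h5
  have hgrid : ∀ a b : ℕ, a ≤ b → t - b * h ≤ t - a * h := fun a b hab ↦ by gcongr
  rw [pastWeight, tsum_eq_single l]
  · rw [if_pos]
    · rw [Finset.card_eq_sum_ones, ← Finset.prod_pow_eq_pow_sum, Finset.prod_filter]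
      refine Finset.prod_congr rfl fun j _ ↦ ?_
      rw [hval j]
      have := hc.mono j hs
      rcases this.eq_or_lt with h | h
      · simp [h]
      · simp [h, h.ne]
    · have h6 := (hc.mono i).le_leftLim h4
      exact ⟨by rw [hval]; omega, by rw [hval, hi]⟩
  · intro m hm
    rw [if_neg]
    rintro ⟨h6, h7⟩
    rcases lt_or_gt_of_ne hm with hm | hm
    · have h8 : t - l * h ≤ t - ((m : ℝ≥0) + 1) * h := by exact_mod_cast hgrid (m + 1) l hm
      have h9 := hc.mono i h8
      rw [hval] at h9
      omega
    · have h8 : t - m * h ≤ t - ((l : ℝ≥0) + 1) * h := by exact_mod_cast hgrid (l + 1) m hm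
      have h9 := (hc.mono i).le_leftLim (h8.trans_lt h4)
      omega

theorem eventually_futureIndicator : ∀ᶠ h : ℝ≥0 in 𝓝[>] 0, ∀ i,
    futureIndicator c t h i = if nextRequest c t = some i then 1 else 0 := by
  refine eventually_all.2 fun i ↦ ?_
  by_cases hi : nextRequest c t = some i
  · filter_upwards [self_mem_nhdsWithin] with h hh
    rw [hc.futureIndicator_of_eq ht hi hh, if_pos hi]
  · obtain ⟨ε, hε, H⟩ := hc.futureIndicator_of_ne ht hi
    filter_upwards [self_mem_nhdsWithin,
      eventually_nhdsWithin_of_eventually_nhds (gt_mem_nhds hε)] with h hh hh'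
    rw [H h hh hh', if_neg hi]

/-- The transform of the equilibrium cost, as the limit of its discretizations. -/
theorem eventually_sum_pastWeight_mul_futureIndicator (π : Equiv.Perm (Fin n)) (z : ℝ≥0∞) :
    ∀ᶠ h : ℝ≥0 in 𝓝[>] 0, ∑ i, z * pastWeight c t h z i * futureIndicator c t h i =
      if 0 < equilibriumCost π c t then z ^ equilibriumCost π c t else 0 := by
  have hfut := hc.eventually_futureIndicator ht
  rcases hn : nextRequest c t with _ | i
  · filter_upwards [hfut] with h hh
    simp [hh, hn, equilibriumCost_eq_zero hn]
  · rw [equilibriumCost_eq ht hn]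
    by_cases hi : 0 < c i t
    · obtain ⟨s, h0, h1, h2, h3⟩ := hc.exists_last_jump hi
      obtain ⟨ε, hε, H⟩ := hc.pastWeight_of_last_jump h0 h1 h2 h3 z
      filter_upwards [hfut, self_mem_nhdsWithin,
        eventually_nhdsWithin_of_eventually_nhds (gt_mem_nhds hε)] with h hh h4 h5
      have hpos : 0 < position π c t i := by
        rw [hc.position_eq_of_requested ht π h1 h2 h3]
        omega
      rw [if_pos hi, if_pos hpos, hc.position_eq_of_requested ht π h1 h2 h3]
      simp only [hh, hn, Option.some_inj, mul_ite, mul_one, mul_zero, Finset.sum_ite_eq,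
        Finset.mem_univ, if_true]
      rw [H h h4 h5, pow_add, pow_one]
    · filter_upwards [hfut] with h hh
      simp only [hh, hn, Option.some_inj, mul_ite, mul_one, mul_zero, Finset.sum_ite_eq,
        Finset.mem_univ, if_true]
      rw [pastWeight_of_eq_zero (by omega)]
      simp [hi]

theorem eventually_sum_futureIndicator :
    ∀ᶠ h : ℝ≥0 in 𝓝[>] 0, ∑ i, futureIndicator c t h i =
      if nextRequest c t = none then 0 else 1 := by
  filter_upwards [hc.eventually_futureIndicator ht] with h hh
  rcases hn : nextRequest c t with _ | i
  · simp [hh, hn]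
  · simp [hh, hn]

end IsSimplePath

end Costs

/-! ### Expectations of products of functions of the increments -/

theorem lintegral_pi_prod {ι : Type*} [Fintype ι] {α : ι → Type*} [∀ i, MeasurableSpace (α i)]
    (μ : ∀ i, Measure (α i)) [∀ i, IsProbabilityMeasure (μ i)] {f : ∀ i, α i → ℝ≥0∞}
    (hf : ∀ i, Measurable (f i)) :
    ∫⁻ x, ∏ i, f i (x i) ∂Measure.pi μ = ∏ i, ∫⁻ y, f i y ∂μ i := by
  rw [lintegral_prod_eq_prod_lintegral_of_indepFun Finset.univ
    (fun i (x : ∀ i, α i) ↦ f i (x i)) (iIndepFun_pi fun i ↦ (hf i).aemeasurable)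
    fun i ↦ (hf i).comp (measurable_pi_apply i)]
  refine Finset.prod_congr rfl fun i _ ↦ ?_
  have := (measurePreserving_eval μ i).lintegral_comp (hf i)
  exact this

theorem lintegral_poissonMeasure_indicator (r : ℝ≥0) (z : ℝ≥0∞) :
    ∫⁻ k, (if k = 0 then 1 else z) ∂poissonMeasure r =
      ENNReal.ofReal (Real.exp (-r)) + z * ENNReal.ofReal (1 - Real.exp (-r)) := by
  have h0 : poissonMeasure r {0} = ENNReal.ofReal (Real.exp (-r)) := by
    rw [poissonMeasure_singleton]
    simp
  have h1 : poissonMeasure r {0}ᶜ = ENNReal.ofReal (1 - Real.exp (-r)) := by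
    rw [prob_compl_eq_one_sub .of_discrete, h0, ENNReal.ofReal_sub _ (Real.exp_nonneg _),
      ENNReal.ofReal_one]
  rw [← lintegral_add_compl (μ := poissonMeasure r) _ (measurableSet_singleton 0), ← h0, ← h1]
  congr 1
  · rw [setLIntegral_congr_fun (f := fun k ↦ if k = 0 then 1 else z) (g := fun _ ↦ 1)
      (measurableSet_singleton 0) fun k hk ↦ if_pos hk]
    simp
  · rw [setLIntegral_congr_fun (f := fun k ↦ if k = 0 then 1 else z) (g := fun _ ↦ z)
      (measurableSet_singleton 0).compl fun k hk ↦ if_neg hk]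
    simp

theorem lintegral_poissonMeasure_eq_zero (r : ℝ≥0) :
    ∫⁻ k, (if k = 0 then 1 else 0) ∂poissonMeasure r = ENNReal.ofReal (Real.exp (-r)) := by
  rw [lintegral_poissonMeasure_indicator, zero_mul, add_zero]

theorem lintegral_poissonMeasure_ne_zero (r : ℝ≥0) :
    ∫⁻ k, (if k = 0 then 0 else 1) ∂poissonMeasure r = ENNReal.ofReal (1 - Real.exp (-r)) := by
  have h : ∀ k : ℕ, (if k = 0 then (0 : ℝ≥0∞) else 1) = ({0}ᶜ : Set ℕ).indicator 1 k := by
    intro k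
    by_cases hk : k = 0 <;> simp [hk]
  simp_rw [h]
  rw [lintegral_indicator_one .of_discrete, prob_compl_eq_one_sub .of_discrete,
    ENNReal.ofReal_sub _ (Real.exp_nonneg _), ENNReal.ofReal_one, poissonMeasure_singleton]
  simp

variable {Ω : Type*} [MeasurableSpace Ω] {prob : Measure Ω} {n : ℕ} {w : Ω → Fin n → ℝ≥0}
  {N : Fin n → ℝ≥0 → Ω → ℕ}

theorem popularity_le_one (v : Fin n → ℝ≥0) (i : Fin n) : popularity v i ≤ 1 :=
  div_le_one_of_le₀ (Finset.single_le_sum (f := v) (fun _ _ ↦ zero_le) (Finset.mem_univ i))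
    zero_le

theorem sum_popularity (v : Fin n → ℝ≥0) :
    ∑ i, popularity v i = if ∑ i, v i = 0 then 0 else 1 := by
  simp only [popularity, ← Finset.sum_div]
  split_ifs with h
  · simp [h]
  · exact div_self h

theorem measurable_popularity (i : Fin n) : Measurable fun v : Fin n → ℝ≥0 ↦ popularity v i := by
  unfold popularity
  fun_prop

namespace IsRequestProcess

theorem ae_monotone (hN : IsRequestProcess prob w N) :
    ∀ᵐ ω ∂prob, ∀ i, Monotone fun t ↦ N i t ω := by
  filter_upwards [hN.paths] with ω h i
  exact (h i).2.1

/-- The array of increments takes countably many values, so its point probabilities determine all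
expectations. Given the weights, each is a point mass of a product of Poisson laws, and product
functionals factor. -/
theorem lintegral_prod (hN : IsRequestProcess prob w N) (hw : Measurable w) {m : ℕ}
    {τ : Fin (m + 1) → ℝ≥0} (hτ : Monotone τ) (g : Fin n → Fin m → ℕ → ℝ≥0∞) :
    ∫⁻ ω, ∏ i, ∏ l, g i l (N i (τ l.succ) ω - N i (τ l.castSucc) ω) ∂prob =
      ∫⁻ ω, ∏ i, ∏ l, ∫⁻ k, g i l k
        ∂poissonMeasure (popularity (w ω) i * (τ l.succ - τ l.castSucc)) ∂prob := by
  set X : Ω → Fin n → Fin m → ℕ := fun ω i l ↦ N i (τ l.succ) ω - N i (τ l.castSucc) ω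
  set ρ : Ω → Fin n → Fin m → ℝ≥0 :=
    fun ω i l ↦ popularity (w ω) i * (τ l.succ - τ l.castSucc)
  have hX : Measurable X := by
    refine measurable_pi_lambda _ fun i ↦ measurable_pi_lambda _ fun l ↦ ?_
    exact (hN.measurable i _).sub (hN.measurable i _)
  have hρ : ∀ i l, Measurable fun ω ↦ ρ ω i l := fun i l ↦
    ((measurable_popularity i).comp hw).mul_const _
  have hlaw : ∀ k : Fin n → Fin m → ℕ, prob.map X {k} =
      ∫⁻ ω, ∏ i, ∏ l, poissonMeasure (ρ ω i l) {k i l} ∂prob := by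
    intro k
    have h := hN.law m τ hτ k Set.univ MeasurableSet.univ
    simp only [Set.mem_univ, true_and, Set.preimage_univ, Measure.restrict_univ] at h
    rw [← h, Measure.map_apply hX (measurableSet_singleton k)]
    -- The law is stated with addition; monotone paths turn this into equality of truncated
    -- differences.
    apply measure_congr
    filter_upwards [hN.ae_monotone] with ω hω
    rw [eq_iff_iff]
    change X ω = k ↔ ∀ i l, N i (τ l.succ) ω = N i (τ l.castSucc) ω + k i l
    rw [funext_iff]
    refine forall_congr' fun i ↦ ?_
    rw [funext_iff]
    refine forall_congr' fun l ↦ ?_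
    have := hω i (hτ (Fin.castSucc_lt_succ (i := l)).le)
    simp only [X]
    simp only at this
    omega
  have hpois : ∀ k : Fin n → Fin m → ℕ,
      Measurable fun ω ↦ ∏ i, ∏ l, poissonMeasure (ρ ω i l) {k i l} := by
    intro k
    refine Finset.measurable_prod _ fun i _ ↦ Finset.measurable_prod _ fun l _ ↦ ?_
    simp_rw [poissonMeasure_singleton]
    have := hρ i l
    fun_prop
  have hpi : ∀ (ω : Ω) (k : Fin n → Fin m → ℕ),
      Measure.pi (fun i ↦ Measure.pi fun l ↦ poissonMeasure (ρ ω i l)) {k} =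
        ∏ i, ∏ l, poissonMeasure (ρ ω i l) {k i l} := by
    intro ω k
    simp_rw [Measure.pi_singleton]
  calc ∫⁻ ω, ∏ i, ∏ l, g i l (X ω i l) ∂prob
      = ∫⁻ k, ∏ i, ∏ l, g i l (k i l) ∂(prob.map X) := by
        rw [lintegral_map .of_discrete hX]
    _ = ∑' k : Fin n → Fin m → ℕ, (∏ i, ∏ l, g i l (k i l)) *
          ∫⁻ ω, ∏ i, ∏ l, poissonMeasure (ρ ω i l) {k i l} ∂prob := by
        rw [lintegral_countable']
        simp_rw [hlaw]
    _ = ∫⁻ ω, ∑' k : Fin n → Fin m → ℕ, (∏ i, ∏ l, g i l (k i l)) *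
          ∏ i, ∏ l, poissonMeasure (ρ ω i l) {k i l} ∂prob := by
        rw [lintegral_tsum fun k ↦ ((hpois k).const_mul _).aemeasurable]
        congr 1 with k
        rw [lintegral_const_mul _ (hpois k)]
    _ = ∫⁻ ω, ∏ i, ∏ l, ∫⁻ k, g i l k ∂poissonMeasure (ρ ω i l) ∂prob := by
        congr 1 with ω
        simp_rw [← hpi]
        rw [← lintegral_countable' (fun k : Fin n → Fin m → ℕ ↦ ∏ i, ∏ l, g i l (k i l)),
          lintegral_pi_prod (fun i ↦ Measure.pi fun l ↦ poissonMeasure (ρ ω i l))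
            (f := fun i k ↦ ∏ l, g i l (k l)) fun i ↦ .of_discrete]
        refine Finset.prod_congr rfl fun i _ ↦ ?_
        exact lintegral_pi_prod (fun l ↦ poissonMeasure (ρ ω i l)) fun l ↦ .of_discrete

/-! ### Regularity of the paths -/

/-- Given the weights, the objects are independent and each is requested with probability at most `1
- exp (-(b - a)) ≤ b - a`. One object gives the absence of jumps at fixed times, two objects the
absence of common jumps. -/
theorem measure_forall_lt_le [IsProbabilityMeasure prob] (hN : IsRequestProcess prob w N)
    (hw : Measurable w) (S : Finset (Fin n)) {a b : ℝ≥0} (hab : a ≤ b) :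
    prob {ω | ∀ i ∈ S, N i a ω < N i b ω} ≤ ((b - a : ℝ≥0) : ℝ≥0∞) ^ S.card := by
  have hτ : Monotone ![a, b] := by
    intro x y hxy
    fin_cases x <;> fin_cases y <;> simp_all
  have key := hN.lintegral_prod hw hτ
    fun i _ k ↦ if i ∈ S then (if k = 0 then 0 else 1) else 1
  simp only [Fin.prod_univ_one, Fin.succ_zero_eq_one, Fin.castSucc_zero, Matrix.cons_val_zero,
    Matrix.cons_val_one] at key
  have hle : ∀ ω, ∏ i, ∫⁻ k, (if i ∈ S then (if k = 0 then 0 else 1) else 1)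
      ∂poissonMeasure (popularity (w ω) i * (b - a)) ≤ ((b - a : ℝ≥0) : ℝ≥0∞) ^ S.card := by
    intro ω
    rw [← Finset.prod_const, ← Finset.prod_subset (Finset.subset_univ S)]
    · refine Finset.prod_le_prod' fun i hi ↦ ?_
      simp only [hi, if_true]
      rw [lintegral_poissonMeasure_ne_zero, ← ENNReal.ofReal_coe_nnreal]
      apply ENNReal.ofReal_le_ofReal
      have h1 := Real.add_one_le_exp (-((popularity (w ω) i * (b - a) : ℝ≥0) : ℝ))
      have h2 : popularity (w ω) i * (b - a) ≤ b - a :=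
        mul_le_of_le_one_left zero_le (popularity_le_one _ _)
      rw [← NNReal.coe_le_coe] at h2
      linarith
    · intro i _ hi
      simp [hi]
  calc prob {ω | ∀ i ∈ S, N i a ω < N i b ω}
      = ∫⁻ ω, {ω | ∀ i ∈ S, N i a ω < N i b ω}.indicator 1 ω ∂prob := by
        rw [lintegral_indicator_one]
        simp only [Set.ofPred_forall]
        refine MeasurableSet.iInter fun i ↦ MeasurableSet.iInter fun _ ↦ ?_
        exact measurableSet_lt (hN.measurable i a) (hN.measurable i b)
    _ ≤ ∫⁻ ω, ∏ i, (if i ∈ S then (if N i b ω - N i a ω = 0 then 0 else 1) else 1) ∂prob := by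
        refine lintegral_mono fun ω ↦ ?_
        rw [Set.indicator_apply]
        split_ifs with hω
        · rw [Finset.prod_congr rfl (g := fun _ ↦ (1 : ℝ≥0∞))]
          · simp
          · intro i _
            split_ifs with h1 h2
            · have := hω i h1
              omega
            · rfl
            · rfl
        · exact zero_le
    _ ≤ ∫⁻ _, ((b - a : ℝ≥0) : ℝ≥0∞) ^ S.card ∂prob := by
        exact key.trans_le (lintegral_mono hle)
    _ = _ := by simp

theorem ae_leftLim_eq [IsProbabilityMeasure prob] (hN : IsRequestProcess prob w N)
    (hw : Measurable w) (t : ℝ≥0) : ∀ᵐ ω ∂prob, ∀ i, leftLim (fun s ↦ N i s ω) t = N i t ω := by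
  rcases eq_or_ne t 0 with rfl | ht
  -- At the least time the left limit is by convention the value itself.
  · exact Eventually.of_forall fun ω i ↦ leftLim_zero _
  rw [ae_all_iff]
  intro i
  have hzero : prob {ω | ∀ a < t, N i a ω < N i t ω} = 0 := by
    refine le_antisymm (ge_of_tendsto (f := fun h : ℝ≥0 ↦ (h : ℝ≥0∞)) (x := 𝓝[>] 0) ?_ ?_)
      zero_le
    · have : Tendsto (fun h : ℝ≥0 ↦ (h : ℝ≥0∞)) (𝓝 0) (𝓝 ((0 : ℝ≥0) : ℝ≥0∞)) :=
        ENNReal.continuous_coe.tendsto 0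
      exact this.mono_left nhdsWithin_le_nhds
    · filter_upwards [self_mem_nhdsWithin, eventually_nhdsWithin_of_eventually_nhds
        (gt_mem_nhds (pos_iff_ne_zero.2 ht))] with h hh hht
      have h1 := hN.measure_forall_lt_le hw {i} (tsub_le_self : t - h ≤ t)
      rw [tsub_tsub_cancel_of_le (le_of_lt hht), Finset.card_singleton, pow_one] at h1
      refine (measure_mono fun ω hω ↦ ?_).trans h1
      intro j hj
      rw [Finset.mem_singleton.1 hj]
      exact hω _ (tsub_lt_self (pos_iff_ne_zero.2 ht) hh)
  filter_upwards [hN.ae_monotone, measure_eq_zero_iff_ae_notMem.1 hzero] with ω hω h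
  obtain ⟨a, ha, h⟩ : ∃ a < t, N i t ω ≤ N i a ω := by
    by_contra! hcon
    exact h hcon
  have h1 := (hω i).le_leftLim ha
  have h2 := leftLim_le_self (hω i) t
  omega

/-- A common jump before `T` puts requests of both objects in one of `M + 1` cells of length `T / (M
+ 1)`. By the union bound this has probability at most `T ^ 2 / (M + 1)`, for every `M`. -/
theorem ae_no_common_jump [IsProbabilityMeasure prob] (hN : IsRequestProcess prob w N)
    (hw : Measurable w) {i j : Fin n} (hij : i ≠ j) : ∀ᵐ ω ∂prob, ∀ s,
      leftLim (fun s ↦ N i s ω) s < N i s ω → leftLim (fun s ↦ N j s ω) s < N j s ω → False := by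
  have hzero : ∀ T : ℕ, prob {ω | ∀ M : ℕ, ∃ l < M + 1, ∀ k ∈ ({i, j} : Finset (Fin n)),
      N k (l * (T / (M + 1))) ω < N k ((l + 1) * (T / (M + 1))) ω} = 0 := by
    intro T
    refine le_antisymm (ge_of_tendsto' (f := fun M : ℕ ↦
      (((T : ℝ≥0) ^ 2 / (M + 1) : ℝ≥0) : ℝ≥0∞)) (x := atTop) ?_ fun M ↦ ?_) zero_le
    · rw [← ENNReal.coe_zero, ENNReal.tendsto_coe]
      rw [← NNReal.tendsto_coe]
      push_cast
      have := (tendsto_add_atTop_iff_nat 1).2 (tendsto_const_div_atTop_nhds_zero_nat ((T : ℝ) ^ 2))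
      simpa only [Nat.cast_add, Nat.cast_one] using this
    · set h : ℝ≥0 := T / (M + 1) with hh
      calc _ ≤ prob (⋃ l ∈ Finset.range (M + 1), {ω | ∀ k ∈ ({i, j} : Finset (Fin n)),
              N k (l * h) ω < N k ((l + 1) * h) ω}) := by
            refine measure_mono fun ω hω ↦ ?_
            obtain ⟨l, hl, H⟩ := hω M
            simp only [Set.mem_iUnion]
            exact ⟨l, Finset.mem_range.2 hl, H⟩
        _ ≤ ∑ l ∈ Finset.range (M + 1), prob {ω | ∀ k ∈ ({i, j} : Finset (Fin n)),
              N k (l * h) ω < N k ((l + 1) * h) ω} := measure_biUnion_finset_le _ _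
        _ ≤ ∑ l ∈ Finset.range (M + 1), ((h ^ 2 : ℝ≥0) : ℝ≥0∞) := by
            refine Finset.sum_le_sum fun l _ ↦ ?_
            have h1 := hN.measure_forall_lt_le hw {i, j}
              (show (l : ℝ≥0) * h ≤ (l + 1) * h by gcongr; exact le_self_add)
            rw [Finset.card_pair hij, show ((l : ℝ≥0) + 1) * h - l * h = h by
              rw [add_mul, one_mul, add_tsub_cancel_left]] at h1
            exact_mod_cast h1
        _ = _ := by
            rw [Finset.sum_const, Finset.card_range, nsmul_eq_mul]
            norm_cast
            rw [hh]
            push_cast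
            field_simp
  filter_upwards [hN.paths, ae_all_iff.2 fun T ↦ measure_eq_zero_iff_ae_notMem.1 (hzero T)] with
    ω hω H s hi hj
  have hmono : ∀ k, Monotone fun t ↦ N k t ω := fun k ↦ (hω k).2.1
  have hs : s ≠ 0 := by
    rintro rfl
    rw [leftLim_zero] at hi
    exact lt_irrefl _ hi
  obtain ⟨T, hT⟩ := exists_nat_gt s
  refine H T fun M ↦ ?_
  set h : ℝ≥0 := T / (M + 1) with hh
  have hTpos : (0 : ℝ≥0) < T := lt_of_le_of_lt zero_le hT
  have hpos : 0 < h := by positivity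
  -- Cells are open on the left and closed on the right, so the one containing `s` has index `⌈s /
  -- h⌉ - 1`.
  refine ⟨⌈s / h⌉₊ - 1, ?_, ?_⟩
  · have h1 : ⌈s / h⌉₊ ≤ M + 1 := by
      rw [Nat.ceil_le, div_le_iff₀ hpos, hh]
      push_cast
      rw [mul_div_cancel₀ _ (by positivity)]
      exact hT.le
    omega
  · have h1 : 0 < ⌈s / h⌉₊ := Nat.ceil_pos.2 (div_pos (pos_iff_ne_zero.2 hs) hpos)
    obtain ⟨l, hl⟩ := Nat.exists_eq_succ_of_ne_zero h1.ne'
    have h2 : (l : ℝ≥0) * h < s := by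
      rw [← lt_div_iff₀ hpos]
      apply Nat.lt_ceil.1
      omega
    have h3 : s ≤ ((l : ℝ≥0) + 1) * h := by
      rw [← div_le_iff₀ hpos]
      have := Nat.le_ceil (s / h)
      rw [hl] at this
      exact_mod_cast this
    have h4 : ∀ k, leftLim (fun s ↦ N k s ω) s < N k s ω →
        N k (l * h) ω < N k ((l + 1) * h) ω := fun k hk ↦
      ((hmono k).le_leftLim h2).trans_lt (hk.trans_le (hmono k h3))
    rw [hl]
    intro k hk
    simp only [Nat.succ_eq_add_one, Nat.add_sub_cancel]
    rcases Finset.mem_insert.1 hk with rfl | hk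
    · exact h4 _ hi
    · rw [Finset.mem_singleton.1 hk]
      exact h4 _ hj

theorem ae_isSimplePath [IsProbabilityMeasure prob] (hN : IsRequestProcess prob w N)
    (hw : Measurable w) : ∀ᵐ ω ∂prob, IsSimplePath fun i s ↦ N i s ω := by
  have h : ∀ᵐ ω ∂prob, ∀ i j, i ≠ j → ∀ s,
      leftLim (fun s ↦ N i s ω) s < N i s ω → leftLim (fun s ↦ N j s ω) s < N j s ω → False := by
    simp_rw [ae_all_iff]
    intro i j hij
    exact hN.ae_no_common_jump hw hij
  filter_upwards [hN.paths, h] with ω h1 h2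
  refine ⟨fun i ↦ (h1 i).1, fun i ↦ (h1 i).2.1, fun i s ↦ (h1 i).2.2 s, fun i j s h3 h4 ↦ ?_⟩
  by_contra hij
  exact h2 i j hij s h3 h4

end IsRequestProcess

/-! ### Bounds and measurability of the discretizations -/

section Bounds

variable {n : ℕ} {c : Fin n → ℝ≥0 → ℕ} {t h : ℝ≥0} {z : ℝ≥0∞}

theorem tsum_ite_le_one {p : ℕ → Prop} [DecidablePred p] {b : ℕ → ℝ≥0∞}
    (hp : ∀ l m, p l → p m → l = m) (hb : ∀ l, b l ≤ 1) : ∑' l, (if p l then b l else 0) ≤ 1 := by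
  by_cases h : ∃ l, p l
  · obtain ⟨l, hl⟩ := h
    rw [tsum_eq_single l fun m hm ↦ if_neg fun h ↦ hm (hp m l h hl), if_pos hl]
    exact hb l
  · push Not at h
    simp [h]

/-- Two cells cannot both contribute: a request of `i` in the earlier one spoils the constancy
required by the later one. This and the next bound supply the dominating constant when `h` tends to
zero. -/
theorem futureIndicator_le_one (hc : ∀ i, Monotone (c i)) (i : Fin n) :
    futureIndicator c t h i ≤ 1 := by
  refine tsum_ite_le_one (fun l m hl hm ↦ ?_) fun _ ↦ le_rfl
  have key : ∀ l m : ℕ, c i (t + l * h) < c i (t + (l + 1) * h) → c i (t + l * h) = c i t →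
      c i (t + m * h) = c i t → m ≤ l := by
    intro l m h1 h2 h3
    by_contra! hlm
    have h4 : t + ((l : ℝ≥0) + 1) * h ≤ t + m * h := by
      have : ((l : ℝ≥0) + 1) ≤ m := by exact_mod_cast hlm
      gcongr
    have := hc i h4
    omega
  exact le_antisymm (key m l hm.2 (hm.1 i) (hl.1 i)) (key l m hl.2 (hl.1 i) (hm.1 i))

theorem pastWeight_le_one (hc : ∀ i, Monotone (c i)) (hz : z ≤ 1) (i : Fin n) :
    pastWeight c t h z i ≤ 1 := by
  refine tsum_ite_le_one (fun l m hl hm ↦ ?_) fun l ↦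
    Finset.prod_le_one' fun j _ ↦ by split_ifs <;> simp [hz]
  have key : ∀ l m : ℕ, c i (t - (l + 1) * h) < c i (t - l * h) → c i (t - l * h) = c i t →
      c i (t - m * h) = c i t → m ≤ l := by
    intro l m h1 h2 h3
    by_contra! hlm
    have h4 : t - m * h ≤ t - ((l : ℝ≥0) + 1) * h := by
      have : ((l : ℝ≥0) + 1) ≤ m := by exact_mod_cast hlm
      gcongr
    have := hc i h4
    omega
  exact le_antisymm (key m l hm.1 hm.2 hl.2) (key l m hl.1 hl.2 hm.2)

variable {Ω : Type*} [MeasurableSpace Ω] {N : Fin n → ℝ≥0 → Ω → ℕ}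

theorem measurable_futureIndicator (hN : ∀ i s, Measurable (N i s)) (i : Fin n) :
    Measurable fun ω ↦ futureIndicator (fun j s ↦ N j s ω) t h i := by
  refine Measurable.tsum fun l ↦ Measurable.ite ?_ measurable_const measurable_const
  have h1 : MeasurableSet {ω | ∀ j, N j (t + l * h) ω = N j t ω} := by
    rw [Set.ofPred_forall]
    exact MeasurableSet.iInter fun j ↦ measurableSet_eq_fun (hN j _) (hN j _)
  exact h1.inter (measurableSet_lt (hN i _) (hN i _))

theorem measurable_pastWeight (hN : ∀ i s, Measurable (N i s)) (i : Fin n) :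
    Measurable fun ω ↦ pastWeight (fun j s ↦ N j s ω) t h z i := by
  refine Measurable.tsum fun l ↦ Measurable.ite ?_ ?_ measurable_const
  · exact (measurableSet_lt (hN i _) (hN i _)).inter (measurableSet_eq_fun (hN i _) (hN i _))
  · exact Finset.measurable_prod _ fun j _ ↦
      Measurable.ite (measurableSet_eq_fun (hN j _) (hN j _)) measurable_const measurable_const

end Bounds

/-! ### Expectations of the discretizations -/

section Means

variable {n : ℕ}

/-- The expectation of `ζ ^ X` where `X` is the indicator that a Poisson variable of mean `r` is
positive. -/
noncomputable def hitFactor (ζ r : ℝ) : ℝ := Real.exp (-r) + ζ * (1 - Real.exp (-r))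

/-- The expectation of `ζ ^ k` where `k` is the number of objects other than `i` requested in a time
interval of length `u`. -/
noncomputable def pastKernel (ζ : ℝ) (p : Fin n → ℝ≥0) (i : Fin n) (u : ℝ) : ℝ :=
  ∏ j ∈ Finset.univ.erase i, hitFactor ζ (p j * u)

/-- The conditional expectation of `futureIndicator`, given the popularities. -/
noncomputable def futureMean (p : Fin n → ℝ≥0) (h : ℝ≥0) (i : Fin n) : ℝ≥0∞ :=
  ∑' l : ℕ, ENNReal.ofReal (Real.exp (-((∑ j, p j) * (l * h) : ℝ≥0))) *
    ENNReal.ofReal (1 - Real.exp (-(p i * h : ℝ≥0)))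

/-- The conditional expectation of `pastWeight`, given the popularities. -/
noncomputable def pastMean (ζ : ℝ) (p : Fin n → ℝ≥0) (t h : ℝ≥0) (i : Fin n) : ℝ≥0∞ :=
  ∑' l : ℕ, ENNReal.ofReal (Real.exp (-((p i : ℝ) * min (t : ℝ) (l * h))) -
    Real.exp (-((p i : ℝ) * min (t : ℝ) ((l + 1 : ℕ) * h)))) *
      ENNReal.ofReal (pastKernel ζ p i (min (t : ℝ) (l * h)))

theorem hitFactor_nonneg {ζ r : ℝ} (hζ : 0 ≤ ζ) (hr : 0 ≤ r) : 0 ≤ hitFactor ζ r := by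
  have : Real.exp (-r) ≤ 1 := Real.exp_le_one_iff.2 (by linarith)
  exact add_nonneg (Real.exp_nonneg _) (mul_nonneg hζ (by linarith))

theorem hitFactor_le_one {ζ r : ℝ} (hζ : ζ ≤ 1) (hr : 0 ≤ r) : hitFactor ζ r ≤ 1 := by
  have : Real.exp (-r) ≤ 1 := Real.exp_le_one_iff.2 (by linarith)
  unfold hitFactor
  nlinarith

theorem pastKernel_nonneg {ζ : ℝ} (hζ : 0 ≤ ζ) (p : Fin n → ℝ≥0) (i : Fin n) {u : ℝ}
    (hu : 0 ≤ u) : 0 ≤ pastKernel ζ p i u :=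
  Finset.prod_nonneg fun _ _ ↦ hitFactor_nonneg hζ (by positivity)

theorem pastKernel_le_one {ζ : ℝ} (hζ : 0 ≤ ζ) (hζ' : ζ ≤ 1) (p : Fin n → ℝ≥0) (i : Fin n)
    {u : ℝ} (hu : 0 ≤ u) : pastKernel ζ p i u ≤ 1 :=
  Finset.prod_le_one (fun _ _ ↦ hitFactor_nonneg hζ (by positivity))
    fun _ _ ↦ hitFactor_le_one hζ' (by positivity)

theorem continuous_pastKernel (ζ : ℝ) (p : Fin n → ℝ≥0) (i : Fin n) :
    Continuous (pastKernel ζ p i) := by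
  unfold pastKernel hitFactor
  fun_prop

theorem lintegral_poissonMeasure_hitFactor {ζ : ℝ} (hζ : 0 ≤ ζ) (r : ℝ≥0) :
    ∫⁻ k, (if k = 0 then 1 else ENNReal.ofReal ζ) ∂poissonMeasure r =
      ENNReal.ofReal (hitFactor ζ r) := by
  have : Real.exp (-r) ≤ 1 := Real.exp_le_one_iff.2 (by simp)
  rw [lintegral_poissonMeasure_indicator, ← ENNReal.ofReal_mul hζ,
    ← ENNReal.ofReal_add (Real.exp_nonneg _) (mul_nonneg hζ (by linarith)), hitFactor]

variable {Ω : Type*} [MeasurableSpace Ω] {prob : Measure Ω} {w : Ω → Fin n → ℝ≥0}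
  {N : Fin n → ℝ≥0 → Ω → ℕ}

theorem measurable_lintegral_poissonMeasure {ρ : Ω → ℝ≥0} (hρ : Measurable ρ) (f : ℕ → ℝ≥0∞) :
    Measurable fun ω ↦ ∫⁻ k, f k ∂poissonMeasure (ρ ω) := by
  simp_rw [lintegral_countable', poissonMeasure_singleton]
  fun_prop

namespace IsRequestProcess

/-- The past before `t` enters through two consecutive increments and the future through grid cells
after `t`; conditionally on the weights these are independent, so the expectation factors inside the
integral over the weights. -/
theorem lintegral_prod_mul_prod_mul_futureIndicator (hN : IsRequestProcess prob w N)
    (hw : Measurable w) {a b t : ℝ≥0} (hab : a ≤ b) (hbt : b ≤ t) (h : ℝ≥0) (i : Fin n)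
    (f₀ f₁ : Fin n → ℕ → ℝ≥0∞) :
    ∫⁻ ω, (∏ j, f₀ j (N j b ω - N j a ω)) * (∏ j, f₁ j (N j t ω - N j b ω)) *
        futureIndicator (fun j s ↦ N j s ω) t h i ∂prob =
      ∫⁻ ω, (∏ j, ∫⁻ k, f₀ j k ∂poissonMeasure (popularity (w ω) j * (b - a))) *
        (∏ j, ∫⁻ k, f₁ j k ∂poissonMeasure (popularity (w ω) j * (t - b))) *
          futureMean (popularity (w ω)) h i ∂prob := by
  have hterm : ∀ l : ℕ, ∫⁻ ω, (∏ j, f₀ j (N j b ω - N j a ω)) *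
        (∏ j, f₁ j (N j t ω - N j b ω)) *
        (if (∀ j, N j (t + l * h) ω = N j t ω) ∧ N i (t + l * h) ω < N i (t + (l + 1) * h) ω then 1
          else 0) ∂prob =
      ∫⁻ ω, (∏ j, ∫⁻ k, f₀ j k ∂poissonMeasure (popularity (w ω) j * (b - a))) *
        (∏ j, ∫⁻ k, f₁ j k ∂poissonMeasure (popularity (w ω) j * (t - b))) *
        (ENNReal.ofReal (Real.exp (-((∑ j, popularity (w ω) j) * (l * h) : ℝ≥0))) *
          ENNReal.ofReal (1 - Real.exp (-(popularity (w ω) i * h : ℝ≥0)))) ∂prob := by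
    intro l
    have hτ : Monotone ![a, b, t, t + l * h, t + (l + 1) * h] := by
      rw [Fin.monotone_iff_le_succ]
      intro x
      fin_cases x
      · exact hab
      · exact hbt
      · exact le_self_add
      · change t + l * h ≤ t + (l + 1) * h
        gcongr
        exact le_self_add
    -- The last two factors encode that no object is requested in `(t, t + l * h]` and that `i` is
    -- requested in the following cell.
    have key := hN.lintegral_prod hw hτ fun j ↦ ![f₀ j, f₁ j, fun k ↦ if k = 0 then 1 else 0,
      fun k ↦ if j = i then (if k = 0 then 0 else 1) else 1]
    simp only [Fin.prod_univ_four, Finset.prod_mul_distrib] at key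
    have e1 : ((l : ℝ≥0) + 1) * h - l * h = h := by rw [add_mul, one_mul, add_tsub_cancel_left]
    refine Eq.trans ?_ (key.trans ?_)
    · refine lintegral_congr_ae ?_
      filter_upwards [hN.ae_monotone] with ω hω
      rw [mul_assoc (_ * _)]
      congr 1
      change _ = (∏ j, if N j (t + l * h) ω - N j t ω = 0 then 1 else 0) *
        (∏ j, if j = i then if N j (t + (l + 1) * h) ω - N j (t + l * h) ω = 0 then 0 else 1
          else 1)
      rw [Finset.prod_ite_eq' Finset.univ i, if_pos (Finset.mem_univ i)]
      have hmono : ∀ j, N j t ω ≤ N j (t + l * h) ω := fun j ↦ hω j le_self_add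
      by_cases h1 : ∀ j, N j (t + l * h) ω = N j t ω
      · rw [Finset.prod_eq_one fun j _ ↦ by simp [h1 j], one_mul]
        by_cases h2 : N i (t + l * h) ω < N i (t + (l + 1) * h) ω
        · rw [if_pos ⟨h1, h2⟩, if_neg (by omega)]
        · rw [if_neg (fun h ↦ h2 h.2), if_pos (by omega)]
      · rw [if_neg fun h ↦ h1 h.1]
        push Not at h1
        obtain ⟨j, hj⟩ := h1
        have := hmono j
        rw [Finset.prod_eq_zero (Finset.mem_univ j) (if_neg (by omega)), zero_mul]
    · refine lintegral_congr fun ω ↦ ?_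
      rw [mul_assoc (_ * _)]
      congr 1
      change (∏ j, ∫⁻ k, (if k = 0 then 1 else 0)
        ∂poissonMeasure (popularity (w ω) j * (t + l * h - t))) *
          (∏ j, ∫⁻ k, (if j = i then if k = 0 then 0 else 1 else 1)
        ∂poissonMeasure (popularity (w ω) j * (t + (l + 1) * h - (t + l * h)))) = _
      simp only [lintegral_poissonMeasure_eq_zero, add_tsub_add_eq_tsub_left, e1,
        add_tsub_cancel_left]
      congr 1
      · rw [← ENNReal.ofReal_prod_of_nonneg fun _ _ ↦ Real.exp_nonneg _, ← Real.exp_sum,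
          Finset.sum_neg_distrib, Finset.sum_mul]
        push_cast
        rfl
      · rw [Finset.prod_eq_single i]
        · simp [lintegral_poissonMeasure_ne_zero]
        · intro j _ hj
          simp [hj]
        · simp
  have hmeas : Measurable fun ω ↦
      (∏ j, f₀ j (N j b ω - N j a ω)) * (∏ j, f₁ j (N j t ω - N j b ω)) := by
    refine Measurable.mul ?_ ?_ <;> refine Finset.measurable_prod _ fun j _ ↦ ?_
    · exact (Measurable.of_discrete (f := f₀ j)).comp ((hN.measurable j b).sub (hN.measurable j a))
    · exact (Measurable.of_discrete (f := f₁ j)).comp ((hN.measurable j t).sub (hN.measurable j b))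
  have hmeas' : Measurable fun ω ↦
      (∏ j, ∫⁻ k, f₀ j k ∂poissonMeasure (popularity (w ω) j * (b - a))) *
        (∏ j, ∫⁻ k, f₁ j k ∂poissonMeasure (popularity (w ω) j * (t - b))) := by
    refine Measurable.mul ?_ ?_ <;> refine Finset.measurable_prod _ fun j _ ↦ ?_ <;>
      exact measurable_lintegral_poissonMeasure
        (((measurable_popularity j).comp hw).mul_const _) _
  have hpop : ∀ j, Measurable fun ω ↦ popularity (w ω) j :=
    fun j ↦ (measurable_popularity j).comp hw
  simp_rw [futureIndicator, futureMean, ← ENNReal.tsum_mul_left]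
  rw [lintegral_tsum, lintegral_tsum]
  · exact tsum_congr hterm
  · intro l
    refine (hmeas'.mul (Measurable.mul ?_ ?_)).aemeasurable
    · fun_prop
    · have := hpop i
      fun_prop
  · intro l
    refine (hmeas.mul (Measurable.ite ?_ measurable_const measurable_const)).aemeasurable
    have h1 : MeasurableSet {ω | ∀ j, N j (t + l * h) ω = N j t ω} := by
      rw [Set.ofPred_forall]
      exact MeasurableSet.iInter fun j ↦
        measurableSet_eq_fun (hN.measurable j _) (hN.measurable j _)
    exact h1.inter (measurableSet_lt (hN.measurable i _) (hN.measurable i _))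

theorem lintegral_futureIndicator (hN : IsRequestProcess prob w N) (hw : Measurable w)
    (t h : ℝ≥0) (i : Fin n) :
    ∫⁻ ω, futureIndicator (fun j s ↦ N j s ω) t h i ∂prob =
      ∫⁻ ω, futureMean (popularity (w ω)) h i ∂prob := by
  simpa using hN.lintegral_prod_mul_prod_mul_futureIndicator hw (le_refl t) (le_refl t) h i
    (fun _ _ ↦ 1) (fun _ _ ↦ 1)

theorem lintegral_pastWeight_mul_futureIndicator (hN : IsRequestProcess prob w N)
    (hw : Measurable w) (t h : ℝ≥0) {ζ : ℝ} (hζ : 0 ≤ ζ) (i : Fin n) :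
    ∫⁻ ω, pastWeight (fun j s ↦ N j s ω) t h (ENNReal.ofReal ζ) i *
        futureIndicator (fun j s ↦ N j s ω) t h i ∂prob =
      ∫⁻ ω, pastMean ζ (popularity (w ω)) t h i * futureMean (popularity (w ω)) h i ∂prob := by
  -- `f₀` forces a request of `i` in the cell; `f₁` forbids a later one and charges `ζ` for each
  -- other object requested since.
  set f₀ : Fin n → ℕ → ℝ≥0∞ := fun j k ↦ if j = i then (if k = 0 then 0 else 1) else 1
  set f₁ : Fin n → ℕ → ℝ≥0∞ := fun j k ↦ if j = i then (if k = 0 then 1 else 0) else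
    (if k = 0 then 1 else ENNReal.ofReal ζ)
  have hgrid : ∀ l : ℕ, t - ((l : ℝ≥0) + 1) * h ≤ t - l * h := fun l ↦ by
    gcongr
    exact le_self_add
  have hfut := measurable_futureIndicator (t := t) (h := h) hN.measurable i
  have hpop : ∀ j, Measurable fun ω ↦ popularity (w ω) j :=
    fun j ↦ (measurable_popularity j).comp hw
  have hpast : ∀ᵐ ω ∂prob, pastWeight (fun j s ↦ N j s ω) t h (ENNReal.ofReal ζ) i =
      ∑' l : ℕ, (∏ j, f₀ j (N j (t - l * h) ω - N j (t - (l + 1) * h) ω)) *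
        (∏ j, f₁ j (N j t ω - N j (t - l * h) ω)) := by
    filter_upwards [hN.ae_monotone] with ω hω
    refine tsum_congr fun l ↦ ?_
    have h1 := hω i (tsub_le_self : t - l * h ≤ t)
    have hf₀ : ∏ j, f₀ j (N j (t - l * h) ω - N j (t - (l + 1) * h) ω) =
        if N i (t - (l + 1) * h) ω < N i (t - l * h) ω then 1 else 0 := by
      simp only [f₀]
      rw [Finset.prod_ite_eq' Finset.univ i, if_pos (Finset.mem_univ i)]
      split_ifs <;> first | rfl | omega
    rw [hf₀]
    by_cases h2 : N i (t - (l + 1) * h) ω < N i (t - l * h) ω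
    · rw [if_pos h2, one_mul]
      by_cases h3 : N i (t - l * h) ω = N i t ω
      · rw [if_pos ⟨h2, h3⟩]
        refine Finset.prod_congr rfl fun j _ ↦ ?_
        have h4 := hω j (tsub_le_self : t - l * h ≤ t)
        simp only at h4
        simp only [f₁]
        by_cases hji : j = i
        · subst hji
          simp [h3]
        · rw [if_neg hji]
          split_ifs <;> first | rfl | omega
      · rw [if_neg fun h ↦ h3 h.2, eq_comm]
        refine Finset.prod_eq_zero (Finset.mem_univ i) ?_
        simp only at h1
        simp only [f₁, if_true]
        rw [if_neg (by omega)]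
    · rw [if_neg h2, zero_mul, if_neg fun h ↦ h2 h.1]
  have hmeas : ∀ l : ℕ, Measurable fun ω ↦
      (∏ j, f₀ j (N j (t - l * h) ω - N j (t - (l + 1) * h) ω)) *
        (∏ j, f₁ j (N j t ω - N j (t - l * h) ω)) := by
    intro l
    refine Measurable.mul ?_ ?_ <;> refine Finset.measurable_prod _ fun j _ ↦ ?_
    · exact (Measurable.of_discrete (f := f₀ j)).comp
        ((hN.measurable j _).sub (hN.measurable j _))
    · exact (Measurable.of_discrete (f := f₁ j)).comp
        ((hN.measurable j _).sub (hN.measurable j _))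
  have hfm : Measurable fun ω ↦ futureMean (popularity (w ω)) h i := by
    unfold futureMean
    have := hpop i
    fun_prop
  -- Truncation of the backward grid at time zero is the origin of the minima in `pastMean`.
  have hcoe : ∀ a : ℝ≥0, ((t - (t - a) : ℝ≥0) : ℝ) = min (t : ℝ) a := by
    intro a
    rcases le_total t a with h | h
    · rw [tsub_eq_zero_of_le h, tsub_zero, min_eq_left (by exact_mod_cast h)]
    · rw [tsub_tsub_cancel_of_le h, min_eq_right (by exact_mod_cast h)]
  calc _ = ∫⁻ ω, ∑' l : ℕ, (∏ j, f₀ j (N j (t - l * h) ω - N j (t - (l + 1) * h) ω)) *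
        (∏ j, f₁ j (N j t ω - N j (t - l * h) ω)) *
          futureIndicator (fun j s ↦ N j s ω) t h i ∂prob := by
        refine lintegral_congr_ae ?_
        filter_upwards [hpast] with ω hω
        rw [hω, ENNReal.tsum_mul_right]
    _ = ∑' l : ℕ, ∫⁻ ω,
        (∏ j, ∫⁻ k, f₀ j k ∂poissonMeasure
          (popularity (w ω) j * (t - l * h - (t - (l + 1) * h)))) *
        (∏ j, ∫⁻ k, f₁ j k ∂poissonMeasure (popularity (w ω) j * (t - (t - l * h)))) *
          futureMean (popularity (w ω)) h i ∂prob := by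
        rw [lintegral_tsum]
        · exact tsum_congr fun l ↦
            hN.lintegral_prod_mul_prod_mul_futureIndicator hw (hgrid l) tsub_le_self h i f₀ f₁
        · exact fun l ↦ ((hmeas l).mul hfut).aemeasurable
    _ = _ := by
        rw [← lintegral_tsum]
        · refine lintegral_congr fun ω ↦ ?_
          rw [ENNReal.tsum_mul_right, pastMean]
          congr 1
          refine tsum_congr fun l ↦ ?_
          set p := popularity (w ω)
          have e0 : ∏ j, ∫⁻ k, f₀ j k ∂poissonMeasure (p j * (t - l * h - (t - (l + 1) * h))) =
              ENNReal.ofReal (1 - Real.exp (-(p i * (t - l * h - (t - (l + 1) * h)) : ℝ≥0))) := by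
            rw [Finset.prod_eq_single i]
            · simp only [f₀, if_true]
              exact lintegral_poissonMeasure_ne_zero _
            · intro j _ hj
              simp [f₀, hj]
            · simp
          have e1 : ∏ j, ∫⁻ k, f₁ j k ∂poissonMeasure (p j * (t - (t - l * h))) =
              ENNReal.ofReal (Real.exp (-((p i : ℝ) * min (t : ℝ) (l * h)))) *
                ENNReal.ofReal (pastKernel ζ p i (min (t : ℝ) (l * h))) := by
            rw [← Finset.mul_prod_erase Finset.univ _ (Finset.mem_univ i)]
            congr 1
            · simp only [f₁, if_true]
              rw [lintegral_poissonMeasure_eq_zero, NNReal.coe_mul, hcoe]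
              push_cast
              rfl
            · rw [pastKernel, ENNReal.ofReal_prod_of_nonneg fun j _ ↦
                hitFactor_nonneg hζ (by positivity)]
              refine Finset.prod_congr rfl fun j hj ↦ ?_
              simp only [f₁, if_neg (Finset.ne_of_mem_erase hj)]
              rw [lintegral_poissonMeasure_hitFactor hζ, NNReal.coe_mul, hcoe]
              push_cast
              rfl
          have e2 : ((t - l * h - (t - (l + 1) * h) : ℝ≥0) : ℝ) =
              min (t : ℝ) ((l + 1 : ℕ) * h) - min (t : ℝ) (l * h) := by
            have h1 := hcoe (l * h)
            have h2 := hcoe ((l + 1) * h)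
            rw [NNReal.coe_sub tsub_le_self] at h1 h2
            rw [NNReal.coe_sub (hgrid l)]
            push_cast at h1 h2 ⊢
            linarith
          rw [e0, e1, ← mul_assoc, ← ENNReal.ofReal_mul' (Real.exp_nonneg _), sub_mul, one_mul,
            ← Real.exp_add, NNReal.coe_mul, e2]
          congr 4
          ring_nf
        · intro l
          refine (Measurable.mul (Measurable.mul ?_ ?_) hfm).aemeasurable <;>
          refine Finset.measurable_prod _ fun j _ ↦ ?_ <;>
          exact measurable_lintegral_poissonMeasure ((hpop j).mul_const _) _

end IsRequestProcess

end Means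

/-! ### Limits of the conditional expectations as the mesh tends to zero -/

section MeshLimits

variable {n : ℕ}

theorem futureMean_popularity {v : Fin n → ℝ≥0} (hv : ∑ i, v i ≠ 0) {h : ℝ≥0} (hh : 0 < h)
    (i : Fin n) : futureMean (popularity v) h i =
      ENNReal.ofReal ((1 - Real.exp (-(popularity v i * h : ℝ))) / (1 - Real.exp (-(h : ℝ)))) := by
  have h1 : Real.exp (-(h : ℝ)) < 1 := Real.exp_lt_one_iff.2 (by simpa using hh)
  rw [futureMean, sum_popularity, if_neg hv, ENNReal.tsum_mul_right]
  have h2 : ∀ l : ℕ, ENNReal.ofReal (Real.exp (-((1 * ((l : ℝ≥0) * h) : ℝ≥0) : ℝ))) =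
      ENNReal.ofReal (Real.exp (-(h : ℝ))) ^ l := by
    intro l
    rw [← ENNReal.ofReal_pow (Real.exp_nonneg _), ← Real.exp_nat_mul]
    congr 2
    push_cast
    ring
  simp_rw [h2]
  rw [ENNReal.tsum_geometric, ← ENNReal.ofReal_one, ← ENNReal.ofReal_sub _ (Real.exp_nonneg _),
    ← ENNReal.ofReal_inv_of_pos (by linarith), ← ENNReal.ofReal_mul (by simp [h1.le]),
    div_eq_inv_mul]
  push_cast
  rfl

theorem futureMean_popularity_of_sum_eq_zero {v : Fin n → ℝ≥0} (hv : ∑ i, v i = 0) (h : ℝ≥0)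
    (i : Fin n) : futureMean (popularity v) h i = 0 := by
  simp [futureMean, popularity, hv]

theorem futureMean_le_one (v : Fin n → ℝ≥0) {h : ℝ≥0} (hh : 0 < h) (i : Fin n) :
    futureMean (popularity v) h i ≤ 1 := by
  by_cases hv : ∑ i, v i = 0
  · rw [futureMean_popularity_of_sum_eq_zero hv]
    exact zero_le
  · rw [futureMean_popularity hv hh, ENNReal.ofReal_le_one]
    have h1 : Real.exp (-(h : ℝ)) < 1 := Real.exp_lt_one_iff.2 (by simpa using hh)
    apply div_le_one_of_le₀ _ (by linarith)
    have h2 : (popularity v i : ℝ) ≤ 1 := popularity_le_one v i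
    have h3 : Real.exp (-(h : ℝ)) ≤ Real.exp (-(popularity v i * h : ℝ)) := by
      apply Real.exp_le_exp.2
      nlinarith [h.2]
    linarith

theorem tendsto_coe_nhdsGT_zero :
    Tendsto (fun h : ℝ≥0 ↦ (h : ℝ)) (𝓝[>] 0) (𝓝[>] 0) := by
  refine tendsto_nhdsWithin_iff.2 ⟨?_, ?_⟩
  · exact (NNReal.continuous_coe.tendsto' 0 0 rfl).mono_left nhdsWithin_le_nhds
  · filter_upwards [self_mem_nhdsWithin] with h hh
    exact_mod_cast hh

theorem tendsto_one_sub_exp_div (p : ℝ) :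
    Tendsto (fun h : ℝ ↦ h⁻¹ * (1 - Real.exp (-(p * h)))) (𝓝[>] 0) (𝓝 p) := by
  have h1 : HasDerivAt (fun h : ℝ ↦ 1 - Real.exp (-(p * h))) p 0 := by
    have h2 : HasDerivAt (fun h : ℝ ↦ -(p * h)) (-p) 0 := by
      simpa using ((hasDerivAt_id (0 : ℝ)).const_mul p).fun_neg
    simpa using h2.exp.const_sub 1
  simpa using h1.tendsto_slope_zero_right

/-- With total rate one, summing the geometric series leaves a ratio of two difference quotients at
zero, with limits `p i` and `1`. -/
theorem tendsto_futureMean (v : Fin n → ℝ≥0) (i : Fin n) :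
    Tendsto (fun h ↦ futureMean (popularity v) h i) (𝓝[>] 0) (𝓝 (popularity v i)) := by
  by_cases hv : ∑ i, v i = 0
  · simp_rw [futureMean_popularity_of_sum_eq_zero hv]
    have : popularity v i = 0 := by simp [popularity, hv]
    rw [this]
    exact tendsto_const_nhds
  · rw [← ENNReal.ofReal_coe_nnreal]
    have h1 := (tendsto_one_sub_exp_div (popularity v i)).comp tendsto_coe_nhdsGT_zero
    have h2 := (tendsto_one_sub_exp_div 1).comp tendsto_coe_nhdsGT_zero
    have h3 := ENNReal.tendsto_ofReal (h1.div h2 one_ne_zero)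
    rw [div_one] at h3
    refine h3.congr' ?_
    filter_upwards [self_mem_nhdsWithin] with h hh
    have hh' : (h : ℝ) ≠ 0 := by simpa using (ne_of_gt hh)
    rw [futureMean_popularity hv hh]
    simp only [Function.comp_apply, Pi.div_apply, one_mul]
    rw [mul_div_mul_left _ _ (inv_ne_zero hh')]

theorem setLIntegral_mul_exp {p a b : ℝ} (hp : 0 ≤ p) (hab : a ≤ b) :
    ∫⁻ u in Set.Ico a b, ENNReal.ofReal (p * Real.exp (-(p * u))) =
      ENNReal.ofReal (Real.exp (-(p * a)) - Real.exp (-(p * b))) := by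
  have hcont : Continuous fun u : ℝ ↦ p * Real.exp (-(p * u)) := by fun_prop
  rw [← ofReal_integral_eq_lintegral_ofReal]
  · rw [integral_Ico_eq_integral_Ioc, ← intervalIntegral.integral_of_le hab,
      intervalIntegral.integral_eq_sub_of_hasDerivAt (f := fun u ↦ -Real.exp (-(p * u)))]
    · congr 1
      ring
    · intro u _
      have h2 : HasDerivAt (fun h : ℝ ↦ -(p * h)) (-p) u := by
        simpa using ((hasDerivAt_id u).const_mul p).fun_neg
      convert h2.exp.fun_neg using 1
      ring
    · exact hcont.intervalIntegrable _ _
  · exact (hcont.integrableOn_Icc).mono_set Set.Ico_subset_Icc_self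
  · exact Eventually.of_forall fun u ↦ by positivity

theorem mem_Ico_min_iff {t h u : ℝ} (hh : 0 < h) (hu : 0 ≤ u) (hut : u < t) (l : ℕ) :
    u ∈ Set.Ico (min t (l * h)) (min t ((l + 1 : ℕ) * h)) ↔ ⌊u / h⌋₊ = l := by
  rw [Nat.floor_eq_iff (div_nonneg hu hh.le), le_div_iff₀ hh, div_lt_iff₀ hh, Set.mem_Ico,
    min_le_iff, lt_min_iff]
  push_cast
  constructor
  · rintro ⟨h1 | h1, h2, h3⟩
    · linarith
    · exact ⟨h1, h3⟩
  · rintro ⟨h1, h2⟩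
    exact ⟨Or.inr h1, hut, h2⟩

theorem Ico_min_subset {t h : ℝ} (hh : 0 < h) (ht : 0 ≤ t) (l : ℕ) :
    Set.Ico (min t (l * h)) (min t ((l + 1 : ℕ) * h)) ⊆ Set.Ico 0 t := by
  rintro u ⟨h1, h2⟩
  exact ⟨(le_min ht (by positivity)).trans h1, h2.trans_le (min_le_left _ _)⟩

/-- Each difference of exponentials is the integral of the density `p i * exp (-(p i * u))` over a
cell, and the kernel is sampled at the left end `⌊u / h⌋ * h` of that cell. In this form, dominated
convergence applies as `h` tends to zero. -/
theorem pastMean_eq_lintegral (ζ : ℝ) (p : Fin n → ℝ≥0) (t : ℝ≥0) {h : ℝ≥0} (hh : 0 < h)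
    (i : Fin n) : pastMean ζ p t h i = ∫⁻ u in Set.Ico (0 : ℝ) t,
      ENNReal.ofReal (p i * Real.exp (-(p i * u))) *
        ENNReal.ofReal (pastKernel ζ p i (⌊u / h⌋₊ * h)) := by
  have hh' : (0 : ℝ) < h := hh
  set A : ℕ → Set ℝ := fun l ↦ Set.Ico (min (t : ℝ) (l * h)) (min (t : ℝ) ((l + 1 : ℕ) * h))
  have hA : ⋃ l, A l = Set.Ico (0 : ℝ) t := by
    refine subset_antisymm (Set.iUnion_subset (Ico_min_subset hh' t.2)) fun u hu ↦ ?_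
    exact Set.mem_iUnion.2 ⟨_, (mem_Ico_min_iff hh' hu.1 hu.2 _).2 rfl⟩
  have hfloor : ∀ l, ∀ u ∈ A l, ⌊u / h⌋₊ = l := fun l u hu ↦ by
    have h1 := Ico_min_subset hh' t.2 l hu
    exact (mem_Ico_min_iff hh' h1.1 h1.2 l).1 hu
  rw [← hA, lintegral_iUnion (fun l ↦ measurableSet_Ico)]
  · refine tsum_congr fun l ↦ ?_
    have hle : min (t : ℝ) (l * h) ≤ min (t : ℝ) ((l + 1 : ℕ) * h) := by
      push_cast
      gcongr
      linarith
    rw [← setLIntegral_mul_exp (NNReal.coe_nonneg (p i)) hle, ← lintegral_mul_const _ (by fun_prop)]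
    refine setLIntegral_congr_fun measurableSet_Ico fun u hu ↦ ?_
    rw [hfloor l u hu]
    congr 3
    have h1 := Ico_min_subset hh' t.2 l hu
    rcases min_le_iff.1 hu.1 with h2 | h2
    · exact absurd h2 (not_le.2 h1.2)
    · exact min_eq_right (h2.trans h1.2.le)
  · intro l m hlm
    refine Set.disjoint_left.2 fun u hu hu' ↦ hlm ?_
    rw [← hfloor l u hu, ← hfloor m u hu']

theorem lintegral_mul_pastKernel_le_one {ζ : ℝ} (hζ : 0 ≤ ζ) (hζ' : ζ ≤ 1) (p : Fin n → ℝ≥0)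
    (t : ℝ≥0) (i : Fin n) {s : ℝ → ℝ} (hs : ∀ u, 0 ≤ u → 0 ≤ s u) :
    ∫⁻ u in Set.Ico (0 : ℝ) t, ENNReal.ofReal (p i * Real.exp (-(p i * u))) *
      ENNReal.ofReal (pastKernel ζ p i (s u)) ≤ 1 := by
  calc _ ≤ ∫⁻ u in Set.Ico (0 : ℝ) t, ENNReal.ofReal (p i * Real.exp (-(p i * u))) := by
        refine setLIntegral_mono (by fun_prop) fun u hu ↦ mul_le_of_le_one_right' ?_
        rw [ENNReal.ofReal_le_one]
        exact pastKernel_le_one hζ hζ' p i (hs u hu.1)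
    _ ≤ 1 := by
        rw [setLIntegral_mul_exp (NNReal.coe_nonneg (p i)) (NNReal.coe_nonneg t), ENNReal.ofReal_le_one]
        have := Real.exp_nonneg (-((p i : ℝ) * t))
        simp only [mul_zero, neg_zero, Real.exp_zero]
        linarith

theorem pastMean_le_one {ζ : ℝ} (hζ : 0 ≤ ζ) (hζ' : ζ ≤ 1) (p : Fin n → ℝ≥0) (t : ℝ≥0)
    {h : ℝ≥0} (hh : 0 < h) (i : Fin n) : pastMean ζ p t h i ≤ 1 := by
  rw [pastMean_eq_lintegral ζ p t hh]
  exact lintegral_mul_pastKernel_le_one hζ hζ' p t i fun u _ ↦ by positivity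

theorem tendsto_floor_mul (u : ℝ) (hu : 0 ≤ u) :
    Tendsto (fun h : ℝ≥0 ↦ (⌊u / h⌋₊ : ℝ) * h) (𝓝[>] 0) (𝓝 u) := by
  have h1 := tendsto_coe_nhdsGT_zero.mono_right (nhdsWithin_le_nhds (s := Set.Ioi (0 : ℝ)))
  refine tendsto_of_tendsto_of_tendsto_of_le_of_le' (g := fun h : ℝ≥0 ↦ u - h) (h := fun _ ↦ u)
    (by simpa using h1.const_sub u) tendsto_const_nhds ?_ ?_
  all_goals
    filter_upwards [self_mem_nhdsWithin] with h hh
    have hh' : (0 : ℝ) < h := hh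
  · have h2 := Nat.lt_floor_add_one (u / (h : ℝ))
    rw [div_lt_iff₀ hh'] at h2
    linarith
  · rw [← le_div_iff₀ hh']
    exact Nat.floor_le (div_nonneg hu hh'.le)

theorem tendsto_pastMean {ζ : ℝ} (hζ : 0 ≤ ζ) (hζ' : ζ ≤ 1) (p : Fin n → ℝ≥0) (t : ℝ≥0)
    (i : Fin n) : Tendsto (fun h ↦ pastMean ζ p t h i) (𝓝[>] 0)
      (𝓝 (∫⁻ u in Set.Ico (0 : ℝ) t, ENNReal.ofReal (p i * Real.exp (-(p i * u))) *
        ENNReal.ofReal (pastKernel ζ p i u))) := by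
  have hlim : Tendsto (fun h : ℝ≥0 ↦ ∫⁻ u in Set.Ico (0 : ℝ) t,
      ENNReal.ofReal (p i * Real.exp (-(p i * u))) *
        ENNReal.ofReal (pastKernel ζ p i (⌊u / h⌋₊ * h))) (𝓝[>] 0)
      (𝓝 (∫⁻ u in Set.Ico (0 : ℝ) t, ENNReal.ofReal (p i * Real.exp (-(p i * u))) *
        ENNReal.ofReal (pastKernel ζ p i u))) := by
    refine tendsto_lintegral_filter_of_dominated_convergence
      (fun u ↦ ENNReal.ofReal (p i * Real.exp (-(p i * u)))) ?_ ?_ ?_ ?_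
    · refine Eventually.of_forall fun h ↦ ?_
      have h1 : Measurable fun u : ℝ ↦ (⌊u / (h : ℝ)⌋₊ : ℝ) * h :=
        ((measurable_from_nat (f := fun k : ℕ ↦ (k : ℝ))).comp
          (Nat.measurable_floor.comp (measurable_id.div_const _))).mul_const _
      have h2 := (continuous_pastKernel ζ p i).measurable.comp h1
      exact Measurable.mul (by fun_prop) h2.ennreal_ofReal
    · refine Eventually.of_forall fun h ↦ Eventually.of_forall fun u ↦ mul_le_of_le_one_right' ?_
      rw [ENNReal.ofReal_le_one]
      exact pastKernel_le_one hζ hζ' p i (by positivity)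
    · rw [setLIntegral_mul_exp (NNReal.coe_nonneg (p i)) (NNReal.coe_nonneg t)]
      exact ENNReal.ofReal_ne_top
    · filter_upwards [ae_restrict_mem measurableSet_Ico] with u hu
      refine ENNReal.Tendsto.const_mul ?_ (Or.inr ENNReal.ofReal_ne_top)
      exact ENNReal.tendsto_ofReal
        (((continuous_pastKernel ζ p i).tendsto u).comp (tendsto_floor_mul u hu.1))
  refine hlim.congr' ?_
  filter_upwards [self_mem_nhdsWithin] with h hh
  rw [pastMean_eq_lintegral ζ p t hh]

end MeshLimits

/-! ### The transforms in terms of the popularities -/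

section ExactFormula

variable {n : ℕ}

/-- The density in `u` of `ζ ^ S` on the event that the first object requested after a given time
was last requested a time `u` ago. -/
noncomputable def costKernel (ζ : ℝ) (p : Fin n → ℝ≥0) (u : ℝ) : ℝ :=
  ∑ i, (p i : ℝ) ^ 2 * Real.exp (-(p i * u)) * (ζ * pastKernel ζ p i u)

/-- The conditional expectation, given the popularities, of `ζ ^ S` on the event `S > 0`, where `S`
is the equilibrium part of the search cost at time `t`. -/
noncomputable def costMean (ζ : ℝ) (p : Fin n → ℝ≥0) (t : ℝ) : ℝ≥0∞ :=
  ∫⁻ u in Set.Ico (0 : ℝ) t, ENNReal.ofReal (costKernel ζ p u)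

theorem sum_lintegral_eq_costMean {ζ : ℝ} (hζ : 0 ≤ ζ) (p : Fin n → ℝ≥0) (t : ℝ) :
    ∑ i, ENNReal.ofReal ζ * ((∫⁻ u in Set.Ico (0 : ℝ) t,
      ENNReal.ofReal (p i * Real.exp (-(p i * u))) * ENNReal.ofReal (pastKernel ζ p i u)) *
        p i) = costMean ζ p t := by
  have hm : ∀ i, Measurable fun u : ℝ ↦ ENNReal.ofReal (p i * Real.exp (-(p i * u))) *
      ENNReal.ofReal (pastKernel ζ p i u) := fun i ↦
    Measurable.mul (by fun_prop) (continuous_pastKernel ζ p i).measurable.ennreal_ofReal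
  rw [costMean]
  calc _ = ∑ i, ∫⁻ u in Set.Ico (0 : ℝ) t, ENNReal.ofReal ζ *
        (ENNReal.ofReal (p i * Real.exp (-(p i * u))) *
          ENNReal.ofReal (pastKernel ζ p i u) * p i) := by
        refine Finset.sum_congr rfl fun i _ ↦ ?_
        rw [lintegral_const_mul _ ((hm i).mul_const _), lintegral_mul_const _ (hm i)]
    _ = ∫⁻ u in Set.Ico (0 : ℝ) t, ∑ i, ENNReal.ofReal ζ *
        (ENNReal.ofReal (p i * Real.exp (-(p i * u))) *
          ENNReal.ofReal (pastKernel ζ p i u) * p i) := by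
        rw [lintegral_finsetSum _ fun i _ ↦ ((hm i).mul_const _).const_mul _]
    _ = _ := by
        refine setLIntegral_congr_fun measurableSet_Ico fun u hu ↦ ?_
        rw [costKernel, ENNReal.ofReal_sum_of_nonneg]
        · refine Finset.sum_congr rfl fun i _ ↦ ?_
          have h1 := pastKernel_nonneg hζ p i hu.1
          rw [← ENNReal.ofReal_coe_nnreal, ← ENNReal.ofReal_mul (by positivity),
            ← ENNReal.ofReal_mul (by positivity), ← ENNReal.ofReal_mul hζ]
          congr 1
          ring
        · intro i _
          have h1 := pastKernel_nonneg hζ p i hu.1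
          positivity

variable {Ω : Type*} [MeasurableSpace Ω] {prob : Measure Ω} {w : Ω → Fin n → ℝ≥0}
  {N : Fin n → ℝ≥0 → Ω → ℕ}

theorem measurable_futureMean_popularity (hw : Measurable w) (h : ℝ≥0) (i : Fin n) :
    Measurable fun ω ↦ futureMean (popularity (w ω)) h i := by
  have hpop : ∀ j, Measurable fun ω ↦ popularity (w ω) j :=
    fun j ↦ (measurable_popularity j).comp hw
  unfold futureMean
  have := hpop i
  fun_prop

theorem measurable_pastMean_popularity (hw : Measurable w) (ζ : ℝ) (t h : ℝ≥0) (i : Fin n) :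
    Measurable fun ω ↦ pastMean ζ (popularity (w ω)) t h i := by
  have hpop : ∀ j, Measurable fun ω ↦ popularity (w ω) j :=
    fun j ↦ (measurable_popularity j).comp hw
  unfold pastMean pastKernel hitFactor
  have := hpop i
  fun_prop

namespace IsRequestProcess

variable [IsProbabilityMeasure prob]

theorem tendsto_discretization (hN : IsRequestProcess prob w N) (hw : Measurable w)
    (π : Ω → Equiv.Perm (Fin n)) (t : ℝ≥0) (z : ℝ≥0∞) :
    ∀ᵐ ω ∂prob, Tendsto (fun h : ℝ≥0 ↦ ∑ i, z * (pastWeight (fun j s ↦ N j s ω) t h z i *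
        futureIndicator (fun j s ↦ N j s ω) t h i)) (𝓝[>] 0)
      (𝓝 (if 0 < equilibriumCost (π ω) (fun j s ↦ N j s ω) t then
        z ^ equilibriumCost (π ω) (fun j s ↦ N j s ω) t else 0)) := by
  filter_upwards [hN.ae_isSimplePath hw, hN.ae_leftLim_eq hw t] with ω h1 h2
  refine tendsto_nhds_of_eventually_eq ?_
  filter_upwards [h1.eventually_sum_pastWeight_mul_futureIndicator h2 (π ω) z] with h hh
  rw [← hh]
  simp_rw [mul_assoc]

omit [IsProbabilityMeasure prob] in
theorem measurable_discretization (hN : IsRequestProcess prob w N) (t h : ℝ≥0) (z : ℝ≥0∞) :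
    Measurable fun ω ↦ ∑ i, z * (pastWeight (fun j s ↦ N j s ω) t h z i *
        futureIndicator (fun j s ↦ N j s ω) t h i) :=
  Finset.measurable_sum _ fun i _ ↦ ((measurable_pastWeight hN.measurable i).mul
    (measurable_futureIndicator hN.measurable i)).const_mul z

/-- Nothing is assumed about measurability of `π`. The cost is almost surely a limit of
discretizations that do not involve the initial list. -/
theorem aemeasurable_equilibriumCost (hN : IsRequestProcess prob w N) (hw : Measurable w)
    (π : Ω → Equiv.Perm (Fin n)) (t : ℝ≥0) (z : ℝ≥0∞) :
    AEMeasurable (fun ω ↦ if 0 < equilibriumCost (π ω) (fun j s ↦ N j s ω) t then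
        z ^ equilibriumCost (π ω) (fun j s ↦ N j s ω) t else 0) prob :=
  aemeasurable_of_tendsto_metrizable_ae (𝓝[>] (0 : ℝ≥0))
    (fun h ↦ (hN.measurable_discretization t h z).aemeasurable)
    (hN.tendsto_discretization hw π t z)

/-- For each `h` the discretized cost and its conditional mean have the same expectation. Both sides
are bounded by `n`, so both limits may be taken under the integral, and they must agree. -/
theorem lintegral_equilibriumCost (hN : IsRequestProcess prob w N) (hw : Measurable w)
    (π : Ω → Equiv.Perm (Fin n)) (t : ℝ≥0) {ζ : ℝ} (hζ : 0 ≤ ζ) (hζ' : ζ ≤ 1) :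
    ∫⁻ ω, (if 0 < equilibriumCost (π ω) (fun j s ↦ N j s ω) t then
        ENNReal.ofReal ζ ^ equilibriumCost (π ω) (fun j s ↦ N j s ω) t else 0) ∂prob =
      ∫⁻ ω, costMean ζ (popularity (w ω)) t ∂prob := by
  have hz : ENNReal.ofReal ζ ≤ 1 := ENNReal.ofReal_le_one.2 hζ'
  have hfin : ∫⁻ _, (n : ℝ≥0∞) ∂prob ≠ ∞ := by simp
  have hbound : ∀ {a b : Fin n → ℝ≥0∞}, (∀ i, a i ≤ 1) → (∀ i, b i ≤ 1) →
      ∑ i, ENNReal.ofReal ζ * (a i * b i) ≤ n := by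
    intro a b ha hb
    calc _ ≤ ∑ i : Fin n, (1 : ℝ≥0∞) :=
          Finset.sum_le_sum fun i _ ↦ mul_le_one' hz (mul_le_one' (ha i) (hb i))
      _ = n := by simp
  have h1 := tendsto_lintegral_filter_of_dominated_convergence (fun _ ↦ (n : ℝ≥0∞))
    (Eventually.of_forall fun h ↦ hN.measurable_discretization t h (ENNReal.ofReal ζ))
    (Eventually.of_forall fun h ↦ by
      filter_upwards [hN.ae_monotone] with ω hω
      exact hbound (pastWeight_le_one hω hz) (futureIndicator_le_one hω)) hfin
    (hN.tendsto_discretization hw π t (ENNReal.ofReal ζ))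
  have hmean : ∀ (h : ℝ≥0) (i : Fin n), Measurable fun ω ↦
      pastMean ζ (popularity (w ω)) t h i * futureMean (popularity (w ω)) h i := fun h i ↦
    (measurable_pastMean_popularity hw ζ t h i).mul (measurable_futureMean_popularity hw h i)
  have h2 := tendsto_lintegral_filter_of_dominated_convergence (μ := prob) (l := 𝓝[>] 0)
    (F := fun h ω ↦ ∑ i, ENNReal.ofReal ζ *
      (pastMean ζ (popularity (w ω)) t h i * futureMean (popularity (w ω)) h i))
    (f := fun ω ↦ costMean ζ (popularity (w ω)) t) (fun _ ↦ (n : ℝ≥0∞))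
    (Eventually.of_forall fun h ↦ Finset.measurable_sum _ fun i _ ↦ (hmean h i).const_mul _)
    (by
      filter_upwards [self_mem_nhdsWithin] with h hh
      exact Eventually.of_forall fun ω ↦ hbound (pastMean_le_one hζ hζ' _ t hh)
        (futureMean_le_one _ hh)) hfin
    (Eventually.of_forall fun ω ↦ by
      rw [← sum_lintegral_eq_costMean hζ]
      refine tendsto_finsetSum _ fun i _ ↦ ENNReal.Tendsto.const_mul ?_
        (Or.inr ENNReal.ofReal_ne_top)
      refine ENNReal.Tendsto.mul (tendsto_pastMean hζ hζ' _ t i) (Or.inr ENNReal.coe_ne_top)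
        (tendsto_futureMean _ i) (Or.inr ?_)
      exact ne_top_of_le_ne_top ENNReal.one_ne_top
        (lintegral_mul_pastKernel_le_one hζ hζ' _ t i fun _ hu ↦ hu))
  refine tendsto_nhds_unique h1 (h2.congr fun h ↦ ?_)
  have hpw : ∀ i : Fin n, Measurable fun ω ↦
      pastWeight (fun j s ↦ N j s ω) t h (ENNReal.ofReal ζ) i *
        futureIndicator (fun j s ↦ N j s ω) t h i := fun i ↦
    (measurable_pastWeight hN.measurable i).mul (measurable_futureIndicator hN.measurable i)
  rw [lintegral_finsetSum _ fun i _ ↦ (hmean h i).const_mul _, lintegral_finsetSum _ fun i _ ↦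
    (hpw i).const_mul _]
  refine Finset.sum_congr rfl fun i _ ↦ ?_
  rw [lintegral_const_mul _ (hmean h i), lintegral_const_mul _ (hpw i),
    hN.lintegral_pastWeight_mul_futureIndicator hw t h hζ i]

theorem tendsto_sum_futureIndicator (hN : IsRequestProcess prob w N) (hw : Measurable w)
    (t : ℝ≥0) :
    ∀ᵐ ω ∂prob, Tendsto (fun h : ℝ≥0 ↦ ∑ i, futureIndicator (fun j s ↦ N j s ω) t h i) (𝓝[>] 0)
      (𝓝 (if nextRequest (fun j s ↦ N j s ω) t = none then 0 else 1)) := by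
  filter_upwards [hN.ae_isSimplePath hw, hN.ae_leftLim_eq hw t] with ω h1 h2
  exact tendsto_nhds_of_eventually_eq (h1.eventually_sum_futureIndicator h2)

theorem aemeasurable_nextRequest (hN : IsRequestProcess prob w N) (hw : Measurable w) (t : ℝ≥0) :
    AEMeasurable (fun ω ↦ if nextRequest (fun j s ↦ N j s ω) t = none then (0 : ℝ≥0∞) else 1)
      prob :=
  aemeasurable_of_tendsto_metrizable_ae (𝓝[>] (0 : ℝ≥0))
    (fun _ ↦ (Finset.measurable_sum _ fun i _ ↦
      measurable_futureIndicator hN.measurable i).aemeasurable)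
    (hN.tendsto_sum_futureIndicator hw t)

/-- There is a next request unless all the weights vanish. -/
theorem lintegral_nextRequest (hN : IsRequestProcess prob w N) (hw : Measurable w) (t : ℝ≥0) :
    ∫⁻ ω, (if nextRequest (fun j s ↦ N j s ω) t = none then (0 : ℝ≥0∞) else 1) ∂prob =
      prob {ω | ∑ i, w ω i = 0}ᶜ := by
  have hfin : ∫⁻ _, (n : ℝ≥0∞) ∂prob ≠ ∞ := by simp
  have hbound : ∀ {a : Fin n → ℝ≥0∞}, (∀ i, a i ≤ 1) → ∑ i, a i ≤ n := by
    intro a ha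
    calc _ ≤ ∑ i : Fin n, (1 : ℝ≥0∞) := Finset.sum_le_sum fun i _ ↦ ha i
      _ = n := by simp
  have h1 := tendsto_lintegral_filter_of_dominated_convergence (fun _ ↦ (n : ℝ≥0∞))
    (Eventually.of_forall fun h ↦ Finset.measurable_sum Finset.univ fun i _ ↦
      measurable_futureIndicator (t := t) (h := h) hN.measurable i)
    (Eventually.of_forall fun h ↦ by
      filter_upwards [hN.ae_monotone] with ω hω
      exact hbound (futureIndicator_le_one hω)) hfin (hN.tendsto_sum_futureIndicator hw t)
  have h2 := tendsto_lintegral_filter_of_dominated_convergence (μ := prob) (l := 𝓝[>] 0)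
    (F := fun h ω ↦ ∑ i, futureMean (popularity (w ω)) h i)
    (f := fun ω ↦ ∑ i, (popularity (w ω) i : ℝ≥0∞)) (fun _ ↦ (n : ℝ≥0∞))
    (Eventually.of_forall fun h ↦ Finset.measurable_sum _ fun i _ ↦
      measurable_futureMean_popularity hw h i)
    (by
      filter_upwards [self_mem_nhdsWithin] with h hh
      exact Eventually.of_forall fun ω ↦ hbound (futureMean_le_one _ hh)) hfin
    (Eventually.of_forall fun ω ↦ tendsto_finsetSum _ fun i _ ↦ tendsto_futureMean _ i)
  have h3 : ∫⁻ ω, ∑ i, (popularity (w ω) i : ℝ≥0∞) ∂prob = prob {ω | ∑ i, w ω i = 0}ᶜ := by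
    have hmeas : MeasurableSet {ω | ∑ i, w ω i = 0} :=
      measurableSet_eq_fun (by fun_prop) measurable_const
    rw [← lintegral_indicator_one hmeas.compl]
    refine lintegral_congr fun ω ↦ ?_
    rw [← ENNReal.ofNNReal_finsetSum, sum_popularity]
    by_cases h : ∑ i, w ω i = 0
    · rw [if_pos h, Set.indicator_of_notMem (show ω ∉ {ω | ∑ i, w ω i = 0}ᶜ from not_not.2 h), ENNReal.coe_zero]
    · rw [if_neg h, Set.indicator_of_mem (show ω ∈ {ω | ∑ i, w ω i = 0}ᶜ from h), ENNReal.coe_one,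
        Pi.one_apply]
  rw [← h3]
  refine tendsto_nhds_unique h1 (h2.congr fun h ↦ ?_)
  rw [lintegral_finsetSum _ fun i _ ↦ measurable_futureMean_popularity hw h i,
    lintegral_finsetSum _ fun i _ ↦ measurable_futureIndicator hN.measurable i]
  exact Finset.sum_congr rfl fun i _ ↦ (hN.lintegral_futureIndicator hw t h i).symm

theorem equilibriumTransform_eq (hN : IsRequestProcess prob w N) (hw : Measurable w)
    (π : Ω → Equiv.Perm (Fin n)) (t : ℝ≥0) {lam : ℝ} (hlam : 0 ≤ lam) :
    equilibriumTransform prob π N t lam =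
      (∫⁻ ω, costMean (Real.exp (-lam)) (popularity (w ω)) t ∂prob).toReal := by
  have hz : Real.exp (-lam) ≤ 1 := Real.exp_le_one_iff.2 (by linarith)
  rw [← hN.lintegral_equilibriumCost hw π t (Real.exp_nonneg _) hz,
    ← integral_toReal (hN.aemeasurable_equilibriumCost hw π t _)]
  · rw [equilibriumTransform]
    refine integral_congr_ae (Eventually.of_forall fun ω ↦ ?_)
    simp only [Set.indicator_apply, Set.mem_ofPred_eq]
    split_ifs with h
    · rw [ENNReal.toReal_pow, ENNReal.toReal_ofReal (Real.exp_nonneg _), ← Real.exp_nat_mul]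
      congr 1
      ring
    · simp
  · refine Eventually.of_forall fun ω ↦ ?_
    split_ifs
    · exact ENNReal.pow_lt_top ENNReal.ofReal_lt_top
    · exact ENNReal.zero_lt_top

/-- Where a next request exists, the two integrands coincide. Elsewhere the search cost is zero,
hence at most `|R|`, and contributes `1`; the probability of this is that of vanishing weights. -/
theorem earlyTransform_eq (hN : IsRequestProcess prob w N) (hw : Measurable w)
    (π : Ω → Equiv.Perm (Fin n)) (t : ℝ≥0) {lam : ℝ} (hlam : 0 ≤ lam) :
    earlyTransform prob π N t lam =
      equilibriumTransform prob π N t lam + prob.real {ω | ∑ i, w ω i = 0} := by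
  have hz : Real.exp (-lam) ≤ 1 := Real.exp_le_one_iff.2 (by linarith)
  set f : Ω → ℝ := fun ω ↦ Set.indicator
    {ω | 0 < equilibriumCost (π ω) (fun i s ↦ N i s ω) t}
      (fun ω ↦ Real.exp (-lam * equilibriumCost (π ω) (fun i s ↦ N i s ω) t)) ω with hf
  set k : Ω → ℝ := fun ω ↦ if nextRequest (fun j s ↦ N j s ω) t = none then 0 else 1 with hk
  have hfi : Integrable f prob := by
    refine Integrable.of_bound (C := 1) ?_ (Eventually.of_forall fun ω ↦ ?_)
    · have h1 := (hN.aemeasurable_equilibriumCost hw π t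
        (ENNReal.ofReal (Real.exp (-lam)))).ennreal_toReal.aestronglyMeasurable
      refine h1.congr (Eventually.of_forall fun ω ↦ ?_)
      simp only [hf, Set.indicator_apply, Set.mem_ofPred_eq]
      split_ifs with h
      · rw [ENNReal.toReal_pow, ENNReal.toReal_ofReal (Real.exp_nonneg _), ← Real.exp_nat_mul]
        congr 1
        ring
      · simp
    · simp only [hf, Set.indicator_apply]
      split_ifs
      · rw [Real.norm_eq_abs, Real.abs_exp, Real.exp_le_one_iff]
        have : 0 ≤ lam * (equilibriumCost (π ω) (fun i s ↦ N i s ω) t : ℝ) := by positivity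
        linarith
      · simp
  have hkm := hN.aemeasurable_nextRequest hw t
  have hk' : k = fun ω ↦
      (if nextRequest (fun j s ↦ N j s ω) t = none then (0 : ℝ≥0∞) else 1).toReal := by
    funext ω
    simp only [hk]
    split_ifs <;> simp
  have hki : Integrable k prob := by
    refine Integrable.of_bound (C := 1) ?_ (Eventually.of_forall fun ω ↦ ?_)
    · rw [hk']
      exact hkm.ennreal_toReal.aestronglyMeasurable
    · simp only [hk]
      split_ifs <;> simp
  have hkint : ∫ ω, k ω ∂prob = 1 - prob.real {ω | ∑ i, w ω i = 0} := by
    have hmeas : MeasurableSet {ω | ∑ i, w ω i = 0} :=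
      measurableSet_eq_fun (by fun_prop) measurable_const
    rw [hk', integral_toReal hkm, hN.lintegral_nextRequest hw t, ← measureReal_def,
      probReal_compl_eq_one_sub hmeas]
    refine Eventually.of_forall fun ω ↦ ?_
    split_ifs <;> simp
  have hsum : earlyTransform prob π N t lam = ∫ ω, (f ω + (1 - k ω)) ∂prob := by
    refine integral_congr_ae ?_
    filter_upwards [hN.ae_isSimplePath hw, hN.ae_leftLim_eq hw t] with ω h1 h2
    simp only [hf, hk, Set.indicator_apply, Set.mem_ofPred_eq]
    by_cases h : nextRequest (fun j s ↦ N j s ω) t = none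
    · simp [h, IsSimplePath.searchCost_eq_zero h, IsSimplePath.equilibriumCost_eq_zero h]
    · obtain ⟨h3, h4⟩ := h1.searchCost_le_iff h2 (π ω) h
      simp only [h, if_false, sub_self, add_zero]
      by_cases h5 : 0 < equilibriumCost (π ω) (fun i s ↦ N i s ω) t
      · rw [if_pos (h3.2 h5), if_pos h5, h4 h5]
      · rw [if_neg (fun h ↦ h5 (h3.1 h)), if_neg h5]
  have hki' : Integrable (fun ω ↦ 1 - k ω) prob := (integrable_const _).sub hki
  rw [hsum, integral_add hfi hki', integral_sub (integrable_const _) hki,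
    hkint, integral_const, probReal_univ, one_smul, sub_sub_cancel]
  rfl

end IsRequestProcess

end ExactFormula

/-! ### A generalized dominated convergence theorem -/

/-- Dominated convergence, with dominating functions whose integrals converge to the integral of
their limit. -/
theorem tendsto_integral_of_le_of_tendsto_integral {ι α : Type*} [MeasurableSpace α]
    {μ : Measure α} {l : Filter ι} [l.IsCountablyGenerated] {F G : ι → α → ℝ} {f g : α → ℝ}
    (hFm : ∀ᶠ a in l, AEStronglyMeasurable (F a) μ) (hG : ∀ a, Integrable (G a) μ)
    (hg : Integrable g μ) (hF0 : ∀ a x, 0 ≤ F a x) (hFG : ∀ a x, F a x ≤ G a x)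
    (hGlim : ∀ᵐ x ∂μ, Tendsto (fun a ↦ G a x) l (𝓝 (g x)))
    (hFlim : ∀ᵐ x ∂μ, Tendsto (fun a ↦ F a x) l (𝓝 (f x)))
    (hint : Tendsto (fun a ↦ ∫ x, G a x ∂μ) l (𝓝 (∫ x, g x ∂μ))) :
    Tendsto (fun a ↦ ∫ x, F a x ∂μ) l (𝓝 (∫ x, f x ∂μ)) := by
  rcases eq_or_neBot l with rfl | hl
  · exact tendsto_bot
  have hfg : ∀ᵐ x ∂μ, f x ≤ g x := by
    filter_upwards [hGlim, hFlim] with x h1 h2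
    exact le_of_tendsto_of_tendsto' h2 h1 fun a ↦ hFG a x
  -- Truncated at `g`, the functions have a fixed dominating function. It remains to control the
  -- excess over `g`.
  have hmin : ∀ {H : ι → α → ℝ} {k : α → ℝ}, (∀ a x, 0 ≤ H a x) →
      (∀ᶠ a in l, AEStronglyMeasurable (H a) μ) →
      (∀ᵐ x ∂μ, Tendsto (fun a ↦ H a x) l (𝓝 (k x))) → (∀ᵐ x ∂μ, k x ≤ g x) →
      Tendsto (fun a ↦ ∫ x, min (H a x) (g x) ∂μ) l (𝓝 (∫ x, k x ∂μ)) := by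
    intro H k h0 hm hlim hle
    refine tendsto_integral_filter_of_dominated_convergence (fun x ↦ |g x|)
      (hm.mono fun a ha ↦ ha.inf hg.1) (Eventually.of_forall fun a ↦ ?_) hg.abs ?_
    · refine Eventually.of_forall fun x ↦ ?_
      rw [Real.norm_eq_abs, abs_le]
      constructor
      · exact le_min ((neg_nonpos.2 (abs_nonneg _)).trans (h0 a x)) (neg_abs_le _)
      · exact (min_le_right _ _).trans (le_abs_self _)
    · filter_upwards [hlim, hle] with x h1 h2
      have := h1.min (tendsto_const_nhds (x := g x))
      rwa [min_eq_left h2] at this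
  have h1 := hmin hF0 hFm hFlim hfg
  have h2 := hmin (fun a x ↦ (hF0 a x).trans (hFG a x)) (Eventually.of_forall fun a ↦ (hG a).1)
    hGlim (Eventually.of_forall fun _ ↦ le_rfl)
  have h3 : Tendsto (fun a ↦ ∫ x, (G a x - min (G a x) (g x)) ∂μ) l (𝓝 0) := by
    have := hint.sub h2
    rw [sub_self] at this
    refine this.congr fun a ↦ ?_
    have hm : Integrable (fun x ↦ min (G a x) (g x)) μ := (hG a).inf hg
    rw [integral_sub (hG a) hm]
  have hFi : ∀ᶠ a in l, Integrable (F a) μ := by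
    filter_upwards [hFm] with a ha
    refine (hG a).mono' ha (Eventually.of_forall fun x ↦ ?_)
    rw [Real.norm_eq_abs, abs_of_nonneg (hF0 a x)]
    exact hFG a x
  -- The excess `y - min y g` increases with `y`, so that of `F` is at most that of `G`, whose
  -- integral tends to zero.
  have hle : ∀ a x, F a x - min (F a x) (g x) ≤ G a x - min (G a x) (g x) := by
    intro a x
    have := hFG a x
    rcases le_total (F a x) (g x) with h | h
    · rw [min_eq_left h, sub_self]
      exact sub_nonneg.2 (min_le_left _ _)
    · rw [min_eq_right h, min_eq_right (h.trans this)]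
      linarith
  have h4 : Tendsto (fun a ↦ ∫ x, (F a x - min (F a x) (g x)) ∂μ) l (𝓝 0) := by
    refine tendsto_of_tendsto_of_tendsto_of_le_of_le' tendsto_const_nhds h3
      (Eventually.of_forall fun a ↦ integral_nonneg fun x ↦ sub_nonneg.2 (min_le_left _ _)) ?_
    filter_upwards [hFi] with a ha
    exact integral_mono (ha.sub (ha.inf hg)) ((hG a).sub ((hG a).inf hg)) (hle a)
  have h5 := h1.add h4
  rw [add_zero] at h5
  refine h5.congr' ?_
  filter_upwards [hFi] with a ha
  have hm : Integrable (fun x ↦ min (F a x) (g x)) μ := ha.inf hg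
  rw [integral_sub ha hm]
  exact add_sub_cancel _ _

/-! ### Laplace transforms of probability measures on the half-line -/

/-- The second derivative of the Laplace transform. -/
noncomputable def laplaceSecond (P : ProbabilityMeasure ℝ≥0) (u : ℝ) : ℝ :=
  ∫ x : ℝ≥0, (x : ℝ) ^ 2 * Real.exp (-(x : ℝ) * u) ∂(P : Measure ℝ≥0)

/-- From `y ^ 2 / 2 ≤ exp y` at `y = x * u`. The bound makes `x ^ 2 * exp (-x * u)` a test function
for weak convergence, but it degenerates as `u` tends to zero. -/
theorem sq_mul_exp_le (x : ℝ≥0) {u : ℝ} (hu : 0 < u) :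
    (x : ℝ) ^ 2 * Real.exp (-(x : ℝ) * u) ≤ 2 / u ^ 2 := by
  have h1 := Real.quadratic_le_exp_of_nonneg (mul_nonneg x.2 hu.le)
  rw [neg_mul, Real.exp_neg, ← div_eq_mul_inv, div_le_div_iff₀ (Real.exp_pos _) (by positivity)]
  have h2 : 0 ≤ (x : ℝ) * u := mul_nonneg x.2 hu.le
  change 1 + (x : ℝ) * u + ((x : ℝ) * u) ^ 2 / 2 ≤ Real.exp ((x : ℝ) * u) at h1
  nlinarith

/-- The test function `x ↦ x ^ 2 * exp (-x * u)`. -/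
noncomputable def sqMulExp (u : ℝ) (hu : 0 < u) : ℝ≥0 →ᵇ ℝ :=
  BoundedContinuousFunction.ofNormedAddCommGroup
    (fun x : ℝ≥0 ↦ (x : ℝ) ^ 2 * Real.exp (-(x : ℝ) * u)) (by fun_prop) (2 / u ^ 2) fun x ↦ by
      rw [Real.norm_eq_abs, abs_of_nonneg (by positivity)]
      exact sq_mul_exp_le x hu

/-- The test function `x ↦ exp (-x * u)`. -/
noncomputable def expNegMul (u : ℝ) (hu : 0 ≤ u) : ℝ≥0 →ᵇ ℝ :=
  BoundedContinuousFunction.ofNormedAddCommGroup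
    (fun x : ℝ≥0 ↦ Real.exp (-(x : ℝ) * u)) (by fun_prop) 1 fun x ↦ by
      rw [Real.norm_eq_abs, Real.abs_exp, Real.exp_le_one_iff, neg_mul, neg_nonpos]
      exact mul_nonneg x.2 hu

theorem integrable_sq_mul_exp (P : ProbabilityMeasure ℝ≥0) {u : ℝ} (hu : 0 < u) :
    Integrable (fun x : ℝ≥0 ↦ (x : ℝ) ^ 2 * Real.exp (-(x : ℝ) * u)) (P : Measure ℝ≥0) :=
  (sqMulExp u hu).integrable (P : Measure ℝ≥0)

theorem tendsto_laplaceSecond {ι : Type*} {l : Filter ι} {Q : ι → ProbabilityMeasure ℝ≥0}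
    {P : ProbabilityMeasure ℝ≥0} (h : Tendsto Q l (𝓝 P)) {u : ℝ} (hu : 0 < u) :
    Tendsto (fun a ↦ laplaceSecond (Q a) u) l (𝓝 (laplaceSecond P u)) :=
  ProbabilityMeasure.tendsto_iff_forall_integral_tendsto.1 h (sqMulExp u hu)

theorem tendsto_laplaceTransform {ι : Type*} {l : Filter ι} {Q : ι → ProbabilityMeasure ℝ≥0}
    {P : ProbabilityMeasure ℝ≥0} (h : Tendsto Q l (𝓝 P)) {u : ℝ} (hu : 0 ≤ u) :
    Tendsto (fun a ↦ laplaceTransform (Q a) u) l (𝓝 (laplaceTransform P u)) :=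
  ProbabilityMeasure.tendsto_iff_forall_integral_tendsto.1 h (expNegMul u hu)

theorem laplaceTransform_le_one (P : ProbabilityMeasure ℝ≥0) {u : ℝ} (hu : 0 ≤ u) :
    laplaceTransform P u ≤ 1 := by
  have h1 : laplaceTransform P u ≤ ∫ _, (1 : ℝ) ∂(P : Measure ℝ≥0) := by
    refine integral_mono ((expNegMul u hu).integrable (P : Measure ℝ≥0)) (integrable_const _)
      fun x ↦ ?_
    simp only
    rw [Real.exp_le_one_iff, neg_mul, neg_nonpos]
    exact mul_nonneg x.2 hu
  simpa using h1

theorem measurable_laplaceTransform (P : ProbabilityMeasure ℝ≥0) :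
    Measurable (laplaceTransform P) := by
  unfold laplaceTransform
  refine StronglyMeasurable.measurable ?_
  refine StronglyMeasurable.integral_prod_left' (f := fun z : ℝ≥0 × ℝ ↦
    Real.exp (-(z.1 : ℝ) * z.2)) ?_
  exact Continuous.stronglyMeasurable (by fun_prop)

theorem laplaceSecond_nonneg (P : ProbabilityMeasure ℝ≥0) (u : ℝ) : 0 ≤ laplaceSecond P u :=
  integral_nonneg fun x ↦ by positivity

theorem integrableOn_sq_mul_exp (x : ℝ≥0) :
    IntegrableOn (fun u : ℝ ↦ (x : ℝ) ^ 2 * Real.exp (-(x : ℝ) * u)) (Set.Ioi 0) := by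
  rcases eq_or_ne x 0 with rfl | hx
  · simp
  · have hx' : (0 : ℝ) < x := by exact_mod_cast pos_iff_ne_zero.2 hx
    exact (integrableOn_exp_mul_Ioi (by linarith : -(x : ℝ) < 0) 0).const_mul _

theorem integral_Ioi_sq_mul_exp (x : ℝ≥0) :
    ∫ u in Set.Ioi (0 : ℝ), (x : ℝ) ^ 2 * Real.exp (-(x : ℝ) * u) = x := by
  rcases eq_or_ne x 0 with rfl | hx
  · simp
  · have hx' : (0 : ℝ) < x := by exact_mod_cast pos_iff_ne_zero.2 hx
    rw [integral_const_mul, integral_exp_mul_Ioi (by linarith : -(x : ℝ) < 0) 0]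
    simp only [mul_zero, Real.exp_zero]
    field_simp

section Fubini

variable {P : ProbabilityMeasure ℝ≥0} (hP : Integrable (fun x : ℝ≥0 ↦ (x : ℝ)) (P : Measure ℝ≥0))
include hP

theorem integrable_uncurry_sq_mul_exp :
    Integrable (Function.uncurry fun (u : ℝ) (x : ℝ≥0) ↦ (x : ℝ) ^ 2 * Real.exp (-(x : ℝ) * u))
      ((volume.restrict (Set.Ioi 0)).prod (P : Measure ℝ≥0)) := by
  rw [integrable_prod_iff']
  · refine ⟨Eventually.of_forall fun x ↦ integrableOn_sq_mul_exp x, ?_⟩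
    refine hP.congr (Eventually.of_forall fun x ↦ ?_)
    simp only [Function.uncurry_apply_pair]
    rw [← integral_Ioi_sq_mul_exp x]
    congr 1
    ext u
    rw [Real.norm_eq_abs, abs_of_nonneg (by positivity), integral_Ioi_sq_mul_exp]
  · exact Continuous.aestronglyMeasurable (by
      unfold Function.uncurry
      fun_prop)

theorem integrableOn_laplaceSecond : IntegrableOn (laplaceSecond P) (Set.Ioi 0) :=
  (integrable_uncurry_sq_mul_exp hP).integral_prod_left

/-- By Fubini, since `x ^ 2 * exp (-x * u)` integrates over `u > 0` to `x`. Convergence of the means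
is therefore convergence of the integrals of the dominating functions. -/
theorem integral_laplaceSecond : ∫ u in Set.Ioi (0 : ℝ), laplaceSecond P u = mean P := by
  unfold laplaceSecond
  rw [integral_integral_swap (integrable_uncurry_sq_mul_exp hP)]
  simp_rw [integral_Ioi_sq_mul_exp]
  rfl

end Fubini

/-! ### Integrals with respect to empirical measures -/

theorem coe_empiricalMeasure {n : ℕ} (hn : n ≠ 0) (v : Fin n → ℝ≥0) :
    (empiricalMeasure v : Measure ℝ≥0) = (n : ℝ≥0∞)⁻¹ • ∑ i, Measure.dirac (v i) :=
  congrArg Subtype.val (dif_neg hn)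

theorem coe_empiricalMeasure_zero (v : Fin 0 → ℝ≥0) :
    (empiricalMeasure v : Measure ℝ≥0) = Measure.dirac 0 :=
  congrArg Subtype.val (dif_pos rfl)

theorem integral_empiricalMeasure {n : ℕ} (hn : n ≠ 0) (v : Fin n → ℝ≥0) (f : ℝ≥0 → ℝ) :
    ∫ x, f x ∂(empiricalMeasure v : Measure ℝ≥0) = (n : ℝ)⁻¹ * ∑ i, f (v i) := by
  rw [coe_empiricalMeasure hn, integral_smul_measure, integral_finsetSum_measure]
  · simp
  · intro i _
    exact integrable_dirac (by simp)

theorem integrable_empiricalMeasure {n : ℕ} (v : Fin n → ℝ≥0) (f : ℝ≥0 → ℝ) :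
    Integrable f (empiricalMeasure v : Measure ℝ≥0) := by
  by_cases hn : n = 0
  · subst hn
    rw [coe_empiricalMeasure_zero]
    exact integrable_dirac (by simp)
  · rw [coe_empiricalMeasure hn]
    refine Integrable.smul_measure ?_ (by simpa using hn)
    rw [integrable_finsetSum_measure]
    exact fun i _ ↦ integrable_dirac (by simp)

theorem mean_empiricalMeasure {n : ℕ} (v : Fin n → ℝ≥0) :
    mean (empiricalMeasure v) = (∑ i, v i) / (n : ℝ≥0) := by
  by_cases hn : n = 0
  · subst hn
    rw [← NNReal.coe_inj]
    change ∫ x, (x : ℝ) ∂(empiricalMeasure v : Measure ℝ≥0) = _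
    rw [coe_empiricalMeasure_zero]
    simp
  · rw [← NNReal.coe_inj]
    change ∫ x, (x : ℝ) ∂(empiricalMeasure v : Measure ℝ≥0) = _
    rw [integral_empiricalMeasure hn, div_eq_inv_mul]
    push_cast
    rfl

/-! ### The limit of the conditional transforms -/

section Bounds

variable {n : ℕ} {ζ : ℝ} (v : Fin n → ℝ≥0)

theorem continuous_costKernel (ζ : ℝ) : Continuous (costKernel ζ v) := by
  unfold costKernel
  refine continuous_finsetSum _ fun i _ ↦ ?_
  have := continuous_pastKernel ζ v i
  fun_prop

theorem costKernel_nonneg (hζ : 0 ≤ ζ) {s : ℝ} (hs : 0 ≤ s) : 0 ≤ costKernel ζ v s :=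
  Finset.sum_nonneg fun i _ ↦ by
    have := pastKernel_nonneg hζ v i hs
    positivity

/-- Change of time unit: the products `p j * u` become `v j * s` when `u` is `s` times the total
weight, and only the prefactor `p i ^ 2` rescales. -/
theorem costKernel_popularity (hv : ∑ i, v i ≠ 0) (ζ s : ℝ) :
    costKernel ζ (popularity v) ((∑ i, v i : ℝ≥0) * s) =
      ((∑ i, v i : ℝ≥0) : ℝ)⁻¹ ^ 2 * costKernel ζ v s := by
  have hv' : ((∑ i, v i : ℝ≥0) : ℝ) ≠ 0 := by exact_mod_cast hv
  have h1 : ∀ j, (popularity v j : ℝ) * ((∑ i, v i : ℝ≥0) * s) = v j * s := by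
    intro j
    rw [popularity, NNReal.coe_div]
    field_simp
  have h2 : ∀ i, pastKernel ζ (popularity v) i ((∑ i, v i : ℝ≥0) * s) = pastKernel ζ v i s := by
    intro i
    unfold pastKernel
    simp_rw [h1]
  unfold costKernel
  rw [Finset.mul_sum]
  refine Finset.sum_congr rfl fun i _ ↦ ?_
  rw [h1, h2, popularity, NNReal.coe_div]
  ring

theorem toReal_costMean (hζ : 0 ≤ ζ) {t : ℝ} (ht : 0 ≤ t) (p : Fin n → ℝ≥0) :
    (costMean ζ p t).toReal = ∫ u in (0 : ℝ)..t, costKernel ζ p u := by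
  rw [intervalIntegral.integral_of_le ht, ← integral_Ico_eq_integral_Ioc, costMean,
    integral_eq_lintegral_of_nonneg_ae]
  · filter_upwards [ae_restrict_mem measurableSet_Ico] with u hu
    exact costKernel_nonneg p hζ hu.1
  · exact (continuous_costKernel p ζ).aestronglyMeasurable

theorem toReal_costMean_popularity (hζ : 0 ≤ ζ) (hv : ∑ i, v i ≠ 0) {t : ℝ} (ht : 0 ≤ t) :
    (costMean ζ (popularity v) t).toReal =
      ((∑ i, v i : ℝ≥0) : ℝ)⁻¹ * ∫ u in (0 : ℝ)..t / (∑ i, v i : ℝ≥0), costKernel ζ v u := by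
  have hv' : ((∑ i, v i : ℝ≥0) : ℝ) ≠ 0 := by exact_mod_cast hv
  have h := intervalIntegral.mul_integral_comp_mul_left (a := 0)
    (b := t / (∑ i, v i : ℝ≥0)) (f := costKernel ζ (popularity v)) ((∑ i, v i : ℝ≥0) : ℝ)
  rw [mul_zero, mul_div_cancel₀ _ hv'] at h
  rw [toReal_costMean hζ ht, ← h]
  simp_rw [costKernel_popularity v hv]
  rw [intervalIntegral.integral_const_mul]
  field_simp

theorem le_hitFactor (hζ : ζ ≤ 1) (r : ℝ) : ζ ≤ hitFactor ζ r := by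
  have := Real.exp_nonneg (-r)
  unfold hitFactor
  nlinarith

theorem hitFactor_mul_pastKernel (ζ : ℝ) (i : Fin n) (s : ℝ) :
    hitFactor ζ (v i * s) * pastKernel ζ v i s = ∏ j, hitFactor ζ (v j * s) :=
  Finset.mul_prod_erase Finset.univ (fun j ↦ hitFactor ζ (v j * s)) (Finset.mem_univ i)

/-- The factor of `i` missing from its product lies between `ζ` and `1`. Completing the product
makes it common to all `i` and costs at most a factor `ζ`, which tends to one. -/
theorem costKernel_le (hζ : 0 ≤ ζ) (hζ' : ζ ≤ 1) {s : ℝ} (hs : 0 ≤ s) :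
    costKernel ζ v s ≤ (∑ i, (v i : ℝ) ^ 2 * Real.exp (-(v i : ℝ) * s)) *
      ∏ j, hitFactor ζ (v j * s) := by
  rw [Finset.sum_mul]
  refine Finset.sum_le_sum fun i _ ↦ ?_
  rw [neg_mul, ← hitFactor_mul_pastKernel v ζ i s]
  have := pastKernel_nonneg hζ v i hs
  have := le_hitFactor hζ' (v i * s)
  gcongr

theorem le_costKernel (hζ : 0 ≤ ζ) (hζ' : ζ ≤ 1) {s : ℝ} (hs : 0 ≤ s) :
    (∑ i, (v i : ℝ) ^ 2 * Real.exp (-(v i : ℝ) * s)) * (ζ * ∏ j, hitFactor ζ (v j * s)) ≤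
      costKernel ζ v s := by
  rw [Finset.sum_mul]
  refine Finset.sum_le_sum fun i _ ↦ ?_
  rw [neg_mul, ← hitFactor_mul_pastKernel v ζ i s]
  have h1 := pastKernel_nonneg hζ v i hs
  have h2 : hitFactor ζ (v i * s) ≤ 1 := hitFactor_le_one hζ' (by positivity)
  gcongr
  exact mul_le_of_le_one_left h1 h2

theorem prod_hitFactor_le_exp (ζ s : ℝ) (hζ : 0 ≤ ζ) (hs : 0 ≤ s) :
    ∏ j, hitFactor ζ (v j * s) ≤
      Real.exp (-((1 - ζ) * ∑ j, (1 - Real.exp (-(v j : ℝ) * s)))) := by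
  rw [Finset.mul_sum, ← Finset.sum_neg_distrib, Real.exp_sum]
  refine Finset.prod_le_prod (fun j _ ↦ hitFactor_nonneg hζ (by positivity)) fun j _ ↦ ?_
  have := Real.add_one_le_exp (-((1 - ζ) * (1 - Real.exp (-(v j : ℝ) * s))))
  rw [hitFactor, ← neg_mul]
  linarith

/-- Each factor is `1 - y` with `1 - y ≥ ζ`, so `(1 - y)⁻¹ = 1 + y / (1 - y) ≤ 1 + y / ζ ≤ exp (y /
ζ)`. The upper bound on the product is `1 - y ≤ exp (-y)`; the two exponents differ only by the
factor `1 / ζ`. -/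
theorem exp_le_prod_hitFactor (s : ℝ) (hζ : 0 < ζ) (hζ' : ζ ≤ 1) (hs : 0 ≤ s) :
    Real.exp (-((1 - ζ) * ∑ j, (1 - Real.exp (-(v j : ℝ) * s))) / ζ) ≤
      ∏ j, hitFactor ζ (v j * s) := by
  rw [Finset.mul_sum, ← Finset.sum_neg_distrib, Finset.sum_div, Real.exp_sum]
  refine Finset.prod_le_prod (fun j _ ↦ Real.exp_nonneg _) fun j _ ↦ ?_
  have hle : Real.exp (-(v j : ℝ) * s) ≤ 1 := by
    rw [Real.exp_le_one_iff, neg_mul, neg_nonpos]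
    positivity
  set y := (1 - ζ) * (1 - Real.exp (-(v j : ℝ) * s)) with hy
  have hy0 : 0 ≤ y := mul_nonneg (by linarith) (by linarith)
  have hyζ : ζ ≤ 1 - y := by
    have := Real.exp_nonneg (-(v j : ℝ) * s)
    nlinarith
  have hfac : hitFactor ζ (v j * s) = 1 - y := by
    rw [hitFactor, hy, ← neg_mul]
    ring
  have h1 : (1 - y)⁻¹ ≤ Real.exp (y / ζ) := by
    calc (1 - y)⁻¹ = y / (1 - y) + 1 := by
          have : 1 - y ≠ 0 := by linarith
          field_simp
          ring
      _ ≤ y / ζ + 1 := by gcongr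
      _ ≤ _ := Real.add_one_le_exp _
  rw [hfac, neg_div, Real.exp_neg]
  exact inv_le_of_inv_le₀ (by linarith) h1

end Bounds

theorem tendsto_natCast_mul_one_sub_exp (lam : ℝ) :
    Tendsto (fun n : ℕ ↦ (n : ℝ) * (1 - Real.exp (-(lam / n)))) atTop (𝓝 lam) := by
  have h1 : Tendsto (fun n : ℕ ↦ ((n : ℝ))⁻¹) atTop (𝓝[>] 0) :=
    tendsto_inv_atTop_nhdsGT_zero.comp tendsto_natCast_atTop_atTop
  refine ((tendsto_one_sub_exp_div lam).comp h1).congr fun n ↦ ?_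
  simp only [Function.comp_apply, inv_inv, div_eq_mul_inv]

theorem tendsto_exp_neg_div_natCast (lam : ℝ) :
    Tendsto (fun n : ℕ ↦ Real.exp (-(lam / n))) atTop (𝓝 1) := by
  have h1 := (tendsto_const_div_atTop_nhds_zero_nat lam).neg.rexp
  simpa using h1

/-! ### Deterministic weights with converging empirical measures and means. -/

section Deterministic

variable {ι : Type*} {l : Filter ι} {m : ι → ℕ} {x : ∀ a, Fin (m a) → ℝ≥0}
  {P : ProbabilityMeasure ℝ≥0}

theorem laplaceSecond_empiricalMeasure {n : ℕ} (hn : n ≠ 0) (v : Fin n → ℝ≥0) (s : ℝ) :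
    laplaceSecond (empiricalMeasure v) s =
      (n : ℝ)⁻¹ * ∑ i, (v i : ℝ) ^ 2 * Real.exp (-(v i : ℝ) * s) :=
  integral_empiricalMeasure hn v _

theorem tendsto_prod_hitFactor (hm : Tendsto m l atTop)
    (hemp : Tendsto (fun a ↦ empiricalMeasure (x a)) l (𝓝 P)) (lam : ℝ≥0) {s : ℝ} (hs : 0 ≤ s) :
    Tendsto (fun a ↦ ∏ j, hitFactor (Real.exp (-((lam : ℝ) / m a))) (x a j * s)) l
      (𝓝 (Real.exp (-(lam : ℝ) * (1 - laplaceTransform P s)))) := by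
  have h1 : Tendsto (fun a ↦ (1 - Real.exp (-((lam : ℝ) / m a))) *
      ∑ j, (1 - Real.exp (-(x a j : ℝ) * s))) l (𝓝 (lam * (1 - laplaceTransform P s))) := by
    -- The exponent is `m * (1 - ζ)`, which tends to `lam`, times the empirical average of `1 - exp
    -- (-x * s)`.
    refine (((tendsto_natCast_mul_one_sub_exp lam).comp hm).mul
      ((tendsto_laplaceTransform hemp hs).const_sub 1)).congr' ?_
    filter_upwards [hm.eventually_ne_atTop 0] with a ha
    have ha' : (m a : ℝ) ≠ 0 := by exact_mod_cast ha
    rw [laplaceTransform, integral_empiricalMeasure ha, Function.comp_apply]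
    simp only [Finset.sum_sub_distrib, Finset.sum_const, Finset.card_univ, Fintype.card_fin,
      nsmul_eq_mul, mul_one]
    generalize ∑ i, Real.exp (-(x a i : ℝ) * s) = σ
    field_simp
  have h2 := (tendsto_exp_neg_div_natCast lam).comp hm
  have hζ : ∀ a, Real.exp (-((lam : ℝ) / m a)) ≤ 1 := fun a ↦ by
    rw [Real.exp_le_one_iff, neg_nonpos]
    positivity
  rw [neg_mul]
  refine tendsto_of_tendsto_of_tendsto_of_le_of_le ?_ h1.neg.rexp
    (fun a ↦ exp_le_prod_hitFactor (x a) s (Real.exp_pos _) (hζ a) hs)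
    (fun a ↦ prod_hitFactor_le_exp (x a) _ s (Real.exp_nonneg _) hs)
  have h3 := (h1.neg.div h2 one_ne_zero).rexp
  rwa [div_one] at h3

theorem tendsto_costKernel (hm : Tendsto m l atTop)
    (hemp : Tendsto (fun a ↦ empiricalMeasure (x a)) l (𝓝 P)) (lam : ℝ≥0) {s : ℝ} (hs : 0 < s) :
    Tendsto (fun a ↦ (m a : ℝ)⁻¹ * costKernel (Real.exp (-((lam : ℝ) / m a))) (x a) s) l
      (𝓝 (laplaceSecond P s * Real.exp (-(lam : ℝ) * (1 - laplaceTransform P s)))) := by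
  have h1 := tendsto_prod_hitFactor hm hemp lam hs.le
  have h2 := (tendsto_exp_neg_div_natCast lam).comp hm
  have h3 := tendsto_laplaceSecond hemp hs
  have hζ : ∀ a, Real.exp (-((lam : ℝ) / m a)) ≤ 1 := fun a ↦ by
    rw [Real.exp_le_one_iff, neg_nonpos]
    positivity
  have h4 := h3.mul (h2.mul h1)
  rw [one_mul] at h4
  refine tendsto_of_tendsto_of_tendsto_of_le_of_le' h4 (h3.mul h1) ?_ ?_ <;>
    filter_upwards [hm.eventually_ne_atTop 0] with a ha <;>
    rw [laplaceSecond_empiricalMeasure ha, mul_assoc]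
  · have := le_costKernel (x a) (Real.exp_nonneg _) (hζ a) hs.le
    rw [Function.comp_apply]
    gcongr
  · have := costKernel_le (x a) (Real.exp_nonneg _) (hζ a) hs.le
    gcongr

theorem natCast_inv_mul_costKernel_le {n : ℕ} (v : Fin n → ℝ≥0) {ζ : ℝ} (hζ : 0 ≤ ζ)
    (hζ' : ζ ≤ 1) {s : ℝ} (hs : 0 ≤ s) :
    (n : ℝ)⁻¹ * costKernel ζ v s ≤ laplaceSecond (empiricalMeasure v) s := by
  by_cases hn : n = 0
  · subst hn
    simpa using laplaceSecond_nonneg _ s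
  · rw [laplaceSecond_empiricalMeasure hn]
    have h1 := costKernel_le v hζ hζ' hs
    have h2 : ∏ j, hitFactor ζ (v j * s) ≤ 1 :=
      Finset.prod_le_one (fun j _ ↦ hitFactor_nonneg hζ (by positivity))
        fun j _ ↦ hitFactor_le_one hζ' (by positivity)
    have h3 : 0 ≤ ∑ i, (v i : ℝ) ^ 2 * Real.exp (-(v i : ℝ) * s) :=
      Finset.sum_nonneg fun i _ ↦ by positivity
    gcongr
    exact h1.trans (mul_le_of_le_one_right h3 h2)

theorem integrableOn_limitKernel (hP : Integrable (fun x : ℝ≥0 ↦ (x : ℝ)) (P : Measure ℝ≥0))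
    (lam : ℝ≥0) : IntegrableOn (fun u ↦ laplaceSecond P u *
      Real.exp (-(lam : ℝ) * (1 - laplaceTransform P u))) (Set.Ioi 0) := by
  refine (integrableOn_laplaceSecond hP).mul_bdd (c := 1) ?_ ?_
  · have := measurable_laplaceTransform P
    exact Measurable.aestronglyMeasurable (by fun_prop)
  · filter_upwards [ae_restrict_mem measurableSet_Ioi] with u hu
    rw [Real.norm_eq_abs, Real.abs_exp, Real.exp_le_one_iff, neg_mul, neg_nonpos]
    exact mul_nonneg lam.2 (sub_nonneg.2 (laplaceTransform_le_one P (le_of_lt hu)))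

/-- After the time change, the integrand converges pointwise and is dominated by the second
derivative of the empirical Laplace transform, whose integral is the empirical mean `M a`. The upper
limit becomes `T a = mean P * t / M a`, which tends to `t`. -/
theorem tendsto_costMean [l.IsCountablyGenerated]
    (hP : Integrable (fun x : ℝ≥0 ↦ (x : ℝ)) (P : Measure ℝ≥0)) (hP0 : mean P ≠ 0)
    (hm : Tendsto m l atTop) (hemp : Tendsto (fun a ↦ empiricalMeasure (x a)) l (𝓝 P))
    (hmean : Tendsto (fun a ↦ (∑ i, x a i) / (m a : ℝ≥0)) l (𝓝 (mean P))) (t lam : ℝ≥0) :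
    Tendsto (fun a ↦ (costMean (Real.exp (-((lam : ℝ) / m a))) (popularity (x a))
      (m a * mean P * t : ℝ≥0)).toReal) l (𝓝 (1 / (mean P : ℝ) * ∫ u in (0 : ℝ)..t,
        laplaceSecond P u * Real.exp (-(lam : ℝ) * (1 - laplaceTransform P u)))) := by
  set M : ι → ℝ≥0 := fun a ↦ (∑ i, x a i) / (m a : ℝ≥0) with hM
  set T : ι → ℝ := fun a ↦ mean P * t / M a with hT
  set ζ : ι → ℝ := fun a ↦ Real.exp (-((lam : ℝ) / m a)) with hζdef
  have hζ : ∀ a, ζ a ≤ 1 := fun a ↦ by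
    rw [Real.exp_le_one_iff, neg_nonpos]
    positivity
  have hP0' : (mean P : ℝ) ≠ 0 := by exact_mod_cast hP0
  have hMlim : Tendsto (fun a ↦ (M a : ℝ)) l (𝓝 (mean P)) := NNReal.tendsto_coe.2 hmean
  have hTlim : Tendsto T l (𝓝 t) := by
    have := (tendsto_const_nhds (x := (mean P : ℝ) * t)).div hMlim hP0'
    rwa [mul_div_cancel_left₀ _ hP0'] at this
  set F : ι → ℝ → ℝ := fun a ↦ (Set.Ioc 0 (T a)).indicator
    fun s ↦ (m a : ℝ)⁻¹ * costKernel (ζ a) (x a) s with hF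
  have hint : Tendsto (fun a ↦ ∫ s in Set.Ioi (0 : ℝ), F a s) l
      (𝓝 (∫ s in Set.Ioi (0 : ℝ), (Set.Ioc (0 : ℝ) t).indicator (fun u ↦ laplaceSecond P u *
        Real.exp (-(lam : ℝ) * (1 - laplaceTransform P u))) s)) := by
    refine tendsto_integral_of_le_of_tendsto_integral
      (G := fun a ↦ laplaceSecond (empiricalMeasure (x a))) (g := laplaceSecond P)
      (Eventually.of_forall fun a ↦ ?_)
      (fun a ↦ integrableOn_laplaceSecond (integrable_empiricalMeasure _ _))
      (integrableOn_laplaceSecond hP) (fun a s ↦ ?_) (fun a s ↦ ?_) ?_ ?_ ?_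
    · exact (((continuous_costKernel (x a) (ζ a)).measurable.const_mul _).indicator
        measurableSet_Ioc).aestronglyMeasurable
    · refine Set.indicator_nonneg (fun s hs ↦ ?_) s
      exact mul_nonneg (by positivity) (costKernel_nonneg _ (Real.exp_nonneg _) hs.1.le)
    · by_cases hs : s ∈ Set.Ioc 0 (T a)
      · simp only [hF, Set.indicator_of_mem hs]
        exact natCast_inv_mul_costKernel_le _ (Real.exp_nonneg _) (hζ a) hs.1.le
      · simp only [hF, Set.indicator_of_notMem hs]
        exact laplaceSecond_nonneg _ _
    · filter_upwards [ae_restrict_mem measurableSet_Ioi] with s hs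
      exact tendsto_laplaceSecond hemp hs
    -- At `s = t` the indicators of `(0, T a]` need not converge; this point is null.
    · have hne : ∀ᵐ s ∂(volume.restrict (Set.Ioi (0 : ℝ))), s ≠ (t : ℝ) :=
        ae_restrict_of_ae (by simp [ae_iff])
      filter_upwards [ae_restrict_mem measurableSet_Ioi, hne] with s hs hst
      rcases lt_or_gt_of_ne hst with hst | hst
      · rw [Set.indicator_of_mem (show s ∈ Set.Ioc (0 : ℝ) t from ⟨hs, hst.le⟩)]
        refine (tendsto_costKernel hm hemp lam hs).congr' ?_
        filter_upwards [hTlim.eventually (lt_mem_nhds hst)] with a ha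
        exact (Set.indicator_of_mem (show s ∈ Set.Ioc 0 (T a) from ⟨hs, ha.le⟩)
          fun s ↦ (m a : ℝ)⁻¹ * costKernel (ζ a) (x a) s).symm
      · rw [Set.indicator_of_notMem (show s ∉ Set.Ioc (0 : ℝ) t from
          fun h ↦ absurd h.2 (not_le.2 hst))]
        refine tendsto_nhds_of_eventually_eq ?_
        filter_upwards [hTlim.eventually (gt_mem_nhds hst)] with a ha
        exact Set.indicator_of_notMem (show s ∉ Set.Ioc 0 (T a) from
          fun h ↦ absurd h.2 (not_le.2 ha)) _
    · simp_rw [integral_laplaceSecond hP,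
        integral_laplaceSecond (integrable_empiricalMeasure _ _), mean_empiricalMeasure]
      exact hMlim
  have hIoc : ∀ (f : ℝ → ℝ) (b : ℝ),
      ∫ s in Set.Ioi (0 : ℝ), (Set.Ioc 0 b).indicator f s = ∫ s in Set.Ioc 0 b, f s := by
    intro f b
    rw [setIntegral_indicator measurableSet_Ioc, Set.inter_eq_right.2 Set.Ioc_subset_Ioi_self]
  rw [hIoc, ← intervalIntegral.integral_of_le (NNReal.coe_nonneg t)] at hint
  refine ((tendsto_const_nhds (x := (1 : ℝ)).div hMlim hP0').mul hint).congr' ?_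
  -- The total weight is `m a * M a`: its inverse supplies the factor `1 / m a` already inside `F`
  -- and the factor `1 / M a` outside.
  filter_upwards [hm.eventually_ne_atTop 0, hmean.eventually_ne hP0] with a ha hMa
  have ha' : (m a : ℝ) ≠ 0 := by exact_mod_cast ha
  have hsum : ∑ i, x a i ≠ 0 := fun h ↦ hMa (by simp only [hM, h, zero_div])
  have hMS : ((∑ i, x a i : ℝ≥0) : ℝ) = m a * M a := by
    simp only [hM, NNReal.coe_div]
    push_cast
    field_simp
  have hMa' : (M a : ℝ) ≠ 0 := by exact_mod_cast hMa
  rw [toReal_costMean_popularity (x a) (Real.exp_nonneg _) hsum (NNReal.coe_nonneg _), hMS]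
  simp only [hF]
  have hTa : ((m a * mean P * t : ℝ≥0) : ℝ) / (m a * M a) = T a := by
    push_cast
    simp only [hT]
    field_simp
  rw [hIoc, hTa, intervalIntegral.integral_of_le (by positivity), integral_const_mul, Pi.div_apply]
  field_simp
  rfl

end Deterministic

/-! ### Convergence in law to a constant -/

section ConvergenceToConstant

variable {Ω : ℕ → Type*} [∀ n, MeasurableSpace (Ω n)] {prob : ∀ n, Measure (Ω n)}
  [∀ n, IsProbabilityMeasure (prob n)]

/-- Convergence in law to a constant implies convergence in probability. -/
theorem tendsto_measureReal_notMem {E : Type*} [TopologicalSpace E]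
    [TopologicalSpace.PseudoMetrizableSpace E] {X : ∀ n, Ω n → E} {e : E}
    (hX : ∀ n (Ψ : E →ᵇ ℝ), AEStronglyMeasurable (fun ω ↦ Ψ (X n ω)) (prob n))
    (h : ∀ Ψ : E →ᵇ ℝ, Tendsto (fun n ↦ ∫ ω, Ψ (X n ω) ∂prob n) atTop (𝓝 (Ψ e)))
    {U : Set E} (hU : U ∈ 𝓝 e) :
    Tendsto (fun n ↦ (prob n).real {ω | X n ω ∉ U}) atTop (𝓝 0) := by
  let := TopologicalSpace.pseudoMetrizableSpacePseudoMetric E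
  obtain ⟨ε, hε, hball⟩ := Metric.mem_nhds_iff.1 hU
  -- This test function vanishes at `e` and equals one at distance at least `ε`, so Markov's
  -- inequality bounds the probability of leaving `U` by its mean.
  set Ψ : E →ᵇ ℝ := BoundedContinuousFunction.ofNormedAddCommGroup
    (fun y ↦ min 1 (dist y e / ε)) (by fun_prop) 1 fun y ↦ by
      rw [Real.norm_eq_abs, abs_of_nonneg (le_min zero_le_one (by positivity))]
      exact min_le_left _ _ with hΨ
  have hΨ0 : ∀ y, 0 ≤ Ψ y := fun y ↦ le_min zero_le_one (by positivity)
  have hΨe : Ψ e = 0 := by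
    change min 1 (dist e e / ε) = 0
    simp
  have h1 := h Ψ
  rw [hΨe] at h1
  refine squeeze_zero (fun _ ↦ measureReal_nonneg) (fun n ↦ ?_) h1
  have hint : Integrable (fun ω ↦ Ψ (X n ω)) (prob n) :=
    Integrable.of_bound (hX n Ψ) ‖Ψ‖ (Eventually.of_forall fun ω ↦ Ψ.norm_coe_le_norm _)
  have h2 := mul_meas_ge_le_integral_of_nonneg (Eventually.of_forall fun ω ↦ hΨ0 (X n ω)) hint 1
  rw [one_mul] at h2
  refine (measureReal_mono fun ω hω ↦ ?_).trans h2
  have h3 : ε ≤ dist (X n ω) e := by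
    by_contra! hlt
    exact hω (hball hlt)
  exact le_min le_rfl ((one_le_div hε).2 h3)

/-- The difference `|X n - L|` is at most `ε / 2` off an event of vanishing probability, and at most
`1 + |L|` on it. -/
theorem tendsto_integral_of_tendsto_measureReal {X : ∀ n, Ω n → ℝ} {L : ℝ}
    (hX : ∀ n, Measurable (X n)) (hX0 : ∀ n ω, 0 ≤ X n ω) (hX1 : ∀ n ω, X n ω ≤ 1)
    (h : ∀ U ∈ 𝓝 L, Tendsto (fun n ↦ (prob n).real {ω | X n ω ∉ U}) atTop (𝓝 0)) :
    Tendsto (fun n ↦ ∫ ω, X n ω ∂prob n) atTop (𝓝 L) := by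
  have hXi : ∀ n, Integrable (X n) (prob n) := fun n ↦
    Integrable.of_bound (hX n).aestronglyMeasurable 1 (Eventually.of_forall fun ω ↦ by
      rw [Real.norm_eq_abs, abs_of_nonneg (hX0 n ω)]
      exact hX1 n ω)
  rw [Metric.tendsto_atTop']
  intro ε hε
  have h1 := (h _ (Metric.ball_mem_nhds L (half_pos hε))).const_mul (1 + |L|)
  rw [mul_zero] at h1
  obtain ⟨n₀, hn₀⟩ := eventually_atTop.1 (h1.eventually (gt_mem_nhds (half_pos hε)))
  refine ⟨n₀, fun n hn ↦ ?_⟩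
  have hA : MeasurableSet {ω | X n ω ∉ Metric.ball L (ε / 2)} :=
    (hX n measurableSet_ball).compl
  set A := {ω | X n ω ∉ Metric.ball L (ε / 2)} with hAdef
  have hbound : ∀ ω, |X n ω - L| ≤ ε / 2 + A.indicator (fun _ ↦ 1 + |L|) ω := by
    intro ω
    by_cases hω : ω ∈ A
    · rw [Set.indicator_of_mem hω]
      have h2 := abs_sub (X n ω) L
      rw [abs_of_nonneg (hX0 n ω)] at h2
      have := hX1 n ω
      linarith
    · rw [Set.indicator_of_notMem hω, add_zero]
      have h2 : X n ω ∈ Metric.ball L (ε / 2) := not_not.1 hω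
      rw [Metric.mem_ball, Real.dist_eq] at h2
      exact h2.le
  have hsub : ∫ ω, X n ω ∂prob n - L = ∫ ω, (X n ω - L) ∂prob n := by
    rw [integral_sub (hXi n) (integrable_const _)]
    simp
  have hind : Integrable (A.indicator fun _ ↦ 1 + |L|) (prob n) :=
    (integrable_const _).indicator hA
  rw [Real.dist_eq, hsub]
  calc |∫ ω, (X n ω - L) ∂prob n| ≤ ∫ ω, |X n ω - L| ∂prob n := abs_integral_le_integral_abs
    _ ≤ ∫ ω, (ε / 2 + A.indicator (fun _ ↦ 1 + |L|) ω) ∂prob n :=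
        integral_mono ((hXi n).sub (integrable_const _)).abs ((integrable_const _).add hind) hbound
    _ = ε / 2 + (1 + |L|) * (prob n).real A := by
        rw [integral_add (integrable_const _) hind, integral_indicator_const _ hA]
        simp [mul_comm]
    _ < ε := by linarith [hn₀ n hn.le]

end ConvergenceToConstant

/-! ### Measurability and scaling -/

theorem continuous_empiricalMeasure (n : ℕ) :
    Continuous (empiricalMeasure : (Fin n → ℝ≥0) → ProbabilityMeasure ℝ≥0) := by
  by_cases hn : n = 0
  · subst hn
    exact continuous_of_const fun v v' ↦ congrArg _ (Subsingleton.elim v v')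
  · rw [continuous_iff_continuousAt]
    intro v
    refine ProbabilityMeasure.tendsto_iff_forall_integral_tendsto.2 fun f ↦ ?_
    simp_rw [integral_empiricalMeasure hn]
    exact Continuous.tendsto (f := fun v : Fin n → ℝ≥0 ↦ (n : ℝ)⁻¹ * ∑ i, f (v i))
      (by fun_prop) v

theorem measurable_costMean {n : ℕ} (ζ t : ℝ) :
    Measurable fun p : Fin n → ℝ≥0 ↦ costMean ζ p t := by
  unfold costMean
  refine Measurable.lintegral_prod_right' (f := fun z : (Fin n → ℝ≥0) × ℝ ↦
    ENNReal.ofReal (costKernel ζ z.1 z.2)) ?_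
  refine (Continuous.measurable ?_).ennreal_ofReal
  unfold costKernel pastKernel hitFactor
  fun_prop

theorem costMean_popularity_le_one {n : ℕ} {ζ : ℝ} (hζ : 0 ≤ ζ) (hζ' : ζ ≤ 1)
    (v : Fin n → ℝ≥0) (t : ℝ≥0) : costMean ζ (popularity v) t ≤ 1 := by
  rw [← sum_lintegral_eq_costMean hζ]
  calc _ ≤ ∑ i, (popularity v i : ℝ≥0∞) := by
        refine Finset.sum_le_sum fun i _ ↦ ?_
        refine (mul_le_of_le_one_left' (ENNReal.ofReal_le_one.2 hζ')).trans
          (mul_le_of_le_one_left' ?_)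
        exact lintegral_mul_pastKernel_le_one hζ hζ' _ t i fun _ hu ↦ hu
    _ ≤ 1 := by
        rw [← ENNReal.ofNNReal_finsetSum, sum_popularity]
        split_ifs <;> simp

/-- The normalization by `Z n` leaves the model unchanged, so limits may be taken along the rescaled
weights. -/
theorem popularity_mul {n : ℕ} {a : ℝ≥0} (ha : a ≠ 0) (v : Fin n → ℝ≥0) :
    popularity (fun i ↦ a * v i) = popularity v := by
  funext i
  simp only [popularity, ← Finset.mul_sum]
  exact mul_div_mul_left _ _ ha

/-! ### The limit of the transforms -/

/-- The filter of convergence of weight vectors of increasing length, in the sense that the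
empirical measures and their means converge to `P` and its mean. -/
noncomputable def weightFilter (P : ProbabilityMeasure ℝ≥0) : Filter (Σ n, Fin n → ℝ≥0) :=
  (comap (fun a ↦ a.1) atTop ⊓ comap (fun a ↦ empiricalMeasure a.2) (𝓝 P)) ⊓
    comap (fun a ↦ (∑ i, a.2 i) / (a.1 : ℝ≥0)) (𝓝 (mean P))

/-- Dominated convergence along this filter requires countable generation. -/
instance (P : ProbabilityMeasure ℝ≥0) : (weightFilter P).IsCountablyGenerated := by
  unfold weightFilter
  infer_instance

section LLN

variable {Ω : ℕ → Type*} [∀ n, MeasurableSpace (Ω n)] {prob : ∀ n, Measure (Ω n)}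
  [∀ n, IsProbabilityMeasure (prob n)] {w : ∀ n, Ω n → Fin n → ℝ≥0}
  {P : ProbabilityMeasure ℝ≥0}

/-- Both convergences are in probability, so a union bound makes them hold jointly: the rescaled
weight vector lies in any set of `weightFilter P` with probability tending to one. Any limit along
that filter thus becomes a limit in probability. -/
theorem LLN.exists_tendsto_measureReal (hP : LLN prob w P) (hw : ∀ n, Measurable (w n)) :
    ∃ Z : ∀ n, Ω n → ℝ≥0, (∀ n, ∀ᵐ ω ∂prob n, 0 < Z n ω) ∧ ∀ S ∈ weightFilter P,
      Tendsto (fun n ↦ (prob n).real {ω | (⟨n, fun i ↦ Z n ω * w n ω i⟩ : Σ n, Fin n → ℝ≥0) ∉ S})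
        atTop (𝓝 0) := by
  obtain ⟨-, -, Z, hZm, hZ, hemp, hmean⟩ := hP
  refine ⟨Z, hZ, fun S hS ↦ ?_⟩
  have hZw : ∀ n, Measurable fun ω ↦ fun i ↦ Z n ω * w n ω i := fun n ↦
    measurable_pi_lambda _ fun i ↦ (hZm n).mul ((measurable_pi_apply i).comp (hw n))
  obtain ⟨S₁, hS₁, V', hV', rfl⟩ := mem_inf_iff.1 hS
  obtain ⟨S₀, hS₀, U', hU', rfl⟩ := mem_inf_iff.1 hS₁
  obtain ⟨U, hU, hUU'⟩ := mem_comap.1 hU'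
  obtain ⟨V, hV, hVV'⟩ := mem_comap.1 hV'
  obtain ⟨A, hA, hAS⟩ := mem_comap.1 hS₀
  -- Continuity of `empiricalMeasure` makes each `Ψ` of it measurable, with no σ-algebra needed on
  -- the space of laws.
  have h1 := tendsto_measureReal_notMem (prob := prob)
    (X := fun n ω ↦ empiricalMeasure fun i ↦ Z n ω * w n ω i) (e := P)
    (fun n Ψ ↦ ((Ψ.continuous.comp (continuous_empiricalMeasure n)).measurable.comp
      (hZw n)).aestronglyMeasurable) hemp hU
  have h2 := tendsto_measureReal_notMem (prob := prob)
    (X := fun n ω ↦ (∑ i, Z n ω * w n ω i) / (n : ℝ≥0)) (e := mean P)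
    (fun n Ψ ↦ (Ψ.continuous.measurable.comp_aemeasurable
      (hmean.forall_aemeasurable n)).aestronglyMeasurable) (fun Ψ ↦ ?_) hV
  · have h3 := h1.add h2
    rw [add_zero] at h3
    refine tendsto_of_tendsto_of_tendsto_of_le_of_le' tendsto_const_nhds h3
      (Eventually.of_forall fun _ ↦ measureReal_nonneg) ?_
    filter_upwards [hA] with n hn
    refine (measureReal_mono fun ω hω ↦ ?_).trans (measureReal_union_le _ _)
    by_contra hcon
    rw [Set.mem_union, not_or] at hcon
    exact hω ⟨⟨hAS hn, hUU' (not_not.1 hcon.1)⟩, hVV' (not_not.1 hcon.2)⟩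
  · have h3 := ProbabilityMeasure.tendsto_iff_forall_integral_tendsto.1 hmean.tendsto Ψ
    simp only [ProbabilityMeasure.coe_mk, Measure.map_const, measure_univ, one_smul,
      integral_dirac] at h3
    refine h3.congr fun n ↦ ?_
    exact integral_map (hmean.forall_aemeasurable n) Ψ.continuous.aestronglyMeasurable

/-- Vanishing weights have empirical mean zero, which stays away from the nonzero `mean P`. -/
theorem LLN.tendsto_measureReal_sum_eq_zero (hP : LLN prob w P) (hw : ∀ n, Measurable (w n)) :
    Tendsto (fun n ↦ (prob n).real {ω | ∑ i, w n ω i = 0}) atTop (𝓝 0) := by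
  obtain ⟨Z, hZ, h⟩ := hP.exists_tendsto_measureReal hw
  have hS : {a : Σ n, Fin n → ℝ≥0 | ∑ i, a.2 i ≠ 0} ∈ weightFilter P := by
    refine mem_inf_of_right ?_
    filter_upwards [preimage_mem_comap (isOpen_ne.mem_nhds hP.2.1)] with a ha h0
    exact ha (by simp [h0])
  refine squeeze_zero (fun _ ↦ measureReal_nonneg) (fun n ↦ ?_) (h _ hS)
  refine measureReal_mono fun ω hω ↦ not_not.2 ?_
  change ∑ i, Z n ω * w n ω i = 0
  rw [← Finset.mul_sum, show ∑ i, w n ω i = 0 from hω, mul_zero]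

/-- The deterministic limit along `weightFilter P` gives convergence in probability of the
conditional transforms, which lie in `[0, 1]`; their expectations are the transforms. -/
theorem LLN.tendsto_equilibriumTransform (hP : LLN prob w P) (hw : ∀ n, Measurable (w n))
    {N : ∀ n, Fin n → ℝ≥0 → Ω n → ℕ} (hN : ∀ n, IsRequestProcess (prob n) (w n) (N n))
    (π : ∀ n, Ω n → Equiv.Perm (Fin n)) (t lam : ℝ≥0) :
    Tendsto (fun n : ℕ ↦ equilibriumTransform (prob n) (π n) (N n) (n * mean P * t) (lam / n))
      atTop (𝓝 (1 / (mean P : ℝ) * ∫ u in (0 : ℝ)..t,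
        laplaceSecond P u * Real.exp (-(lam : ℝ) * (1 - laplaceTransform P u)))) := by
  obtain ⟨Z, hZ, h⟩ := hP.exists_tendsto_measureReal hw
  have hdet := tendsto_costMean (l := weightFilter P) (m := fun a ↦ a.1) (x := fun a ↦ a.2)
    hP.1 hP.2.1 (tendsto_comap.mono_left (inf_le_left.trans inf_le_left))
    (tendsto_comap.mono_left (inf_le_left.trans inf_le_right))
    (tendsto_comap.mono_left inf_le_right) t lam
  have hζ : ∀ n : ℕ, Real.exp (-((lam : ℝ) / n)) ≤ 1 := fun n ↦ by
    rw [Real.exp_le_one_iff, neg_nonpos]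
    positivity
  have hle : ∀ (n : ℕ) (ω : Ω n), costMean (Real.exp (-((lam : ℝ) / n))) (popularity (w n ω))
      ((n * mean P * t : ℝ≥0) : ℝ) ≤ 1 := fun n ω ↦
    costMean_popularity_le_one (Real.exp_nonneg _) (hζ n) _ _
  have hmeas : ∀ n : ℕ, Measurable fun ω ↦ costMean (Real.exp (-((lam : ℝ) / n)))
      (popularity (w n ω)) (n * mean P * t : ℝ≥0) := fun n ↦
    (measurable_costMean _ _).comp
      (measurable_pi_lambda _ fun i ↦ (measurable_popularity i).comp (hw n))
  refine (tendsto_integral_of_tendsto_measureReal (prob := prob) (X := fun n ω ↦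
    (costMean (Real.exp (-((lam : ℝ) / n))) (popularity (w n ω))
      (n * mean P * t : ℝ≥0)).toReal) (fun n ↦ (hmeas n).ennreal_toReal)
      (fun n ω ↦ ENNReal.toReal_nonneg) (fun n ω ↦ ENNReal.toReal_le_of_le_ofReal zero_le_one
        (by simpa using hle n ω)) fun U hU ↦ ?_).congr fun n ↦ ?_
  · refine (h _ (hdet hU)).congr fun n ↦ ?_
    refine measureReal_congr ?_
    filter_upwards [hZ n] with ω hω
    rw [eq_iff_iff]
    change ¬ (costMean _ (popularity fun i ↦ Z n ω * w n ω i) _).toReal ∈ U ↔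
      ¬ (costMean _ (popularity (w n ω)) _).toReal ∈ U
    rw [popularity_mul hω.ne']
  · rw [(hN n).equilibriumTransform_eq (hw n) (π n) _ (by positivity),
      integral_toReal (hmeas n).aemeasurable
        (Eventually.of_forall fun ω ↦ (hle n ω).trans_lt ENNReal.one_lt_top)]

end LLN

end MoveToFront

/-! ### The main theorem. -/

theorem mainTheorem1 {Ω : ℕ → Type*} [∀ n, MeasurableSpace (Ω n)]
    (prob : ∀ n, Measure (Ω n)) [∀ n, IsProbabilityMeasure (prob n)]
    (w : ∀ n, Ω n → Fin n → ℝ≥0) (hw : ∀ n, Measurable (w n))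
    (N : ∀ n, Fin n → ℝ≥0 → Ω n → ℕ)
    (hN : ∀ n, MoveToFront.IsRequestProcess (prob n) (w n) (N n))
    (π : ∀ n, Ω n → Equiv.Perm (Fin n))
    (P : ProbabilityMeasure ℝ≥0) (hP : MoveToFront.LLN prob w P) :
    (∀ n, (∀ᵐ ω ∂prob n, 0 < ∑ i, w n ω i) → ∀ t lam : ℝ≥0,
      MoveToFront.equilibriumTransform (prob n) (π n) (N n) t lam =
        MoveToFront.earlyTransform (prob n) (π n) (N n) t lam) ∧
    (∀ u : ℝ, 0 < u →
      Integrable (fun x : ℝ≥0 ↦ (x : ℝ) ^ 2 * Real.exp (-(x : ℝ) * u)) (P : Measure ℝ≥0)) ∧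
    ∀ t lam : ℝ≥0,
      IntervalIntegrable (fun u : ℝ ↦
        (∫ x : ℝ≥0, (x : ℝ) ^ 2 * Real.exp (-(x : ℝ) * u) ∂(P : Measure ℝ≥0)) *
          Real.exp (-(lam : ℝ) * (1 - MoveToFront.laplaceTransform P u))) volume 0 t ∧
      Tendsto (fun n : ℕ ↦ MoveToFront.equilibriumTransform (prob n) (π n) (N n)
          (n * MoveToFront.mean P * t) (lam / n)) atTop
        (𝓝 (1 / (MoveToFront.mean P : ℝ) * ∫ u in (0 : ℝ)..t,
          (∫ x : ℝ≥0, (x : ℝ) ^ 2 * Real.exp (-(x : ℝ) * u) ∂(P : Measure ℝ≥0)) *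
            Real.exp (-(lam : ℝ) * (1 - MoveToFront.laplaceTransform P u)))) ∧
      Tendsto (fun n : ℕ ↦ MoveToFront.earlyTransform (prob n) (π n) (N n)
          (n * MoveToFront.mean P * t) (lam / n)) atTop
        (𝓝 (1 / (MoveToFront.mean P : ℝ) * ∫ u in (0 : ℝ)..t,
          (∫ x : ℝ≥0, (x : ℝ) ^ 2 * Real.exp (-(x : ℝ) * u) ∂(P : Measure ℝ≥0)) *
            Real.exp (-(lam : ℝ) * (1 - MoveToFront.laplaceTransform P u)))) := by
  have hlam : ∀ (lam : ℝ≥0) (n : ℕ), (0 : ℝ) ≤ lam / n := fun lam n ↦ by positivity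
  refine ⟨fun n hpos t lam ↦ ?_, fun u hu ↦ MoveToFront.integrable_sq_mul_exp P hu,
    fun t lam ↦ ⟨?_, hP.tendsto_equilibriumTransform hw hN π t lam, ?_⟩⟩
  · have hzero : (prob n).real {ω | ∑ i, w n ω i = 0} = 0 := by
      rw [measureReal_def, measure_eq_zero_iff_ae_notMem.2, ENNReal.toReal_zero]
      filter_upwards [hpos] with ω hω
      exact hω.ne'
    rw [(hN n).earlyTransform_eq (hw n) (π n) t (NNReal.coe_nonneg lam), hzero, add_zero]
  · rw [intervalIntegrable_iff_integrableOn_Ioc_of_le (NNReal.coe_nonneg t)]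
    exact (MoveToFront.integrableOn_limitKernel hP.1 lam).mono_set Set.Ioc_subset_Ioi_self
  -- Positivity of the total weight is not available here; the discrepancy between the transforms
  -- vanishes only in the limit.
  · have h := (hP.tendsto_equilibriumTransform hw hN π t lam).add
      (hP.tendsto_measureReal_sum_eq_zero hw)
    rw [add_zero] at h
    refine h.congr fun n ↦ ?_
    rw [(hN n).earlyTransform_eq (hw n) (π n) _ (hlam lam n)]
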